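/- **Model (KIID).** Let $G=(U,V,E)$ be a finite bipartite graph with nonempty sides: $U$ is the set of offline vertices and $V$ the set of online vertex types. There are $T$ rounds. In each round, independently, one vertex arrives, whose type is $v\in V$ with probability $p_v$ ($\sum_v p_v=1$), and $n_v:=Tp_v$ is a positive integer for every $v$. Each vertex $u$ (type $v$) belongs to one group $g(u)$ ($g(v)$); $U(g)$ and $V(g)$ denote the members of the group $g$ in $U$ and $V$. Each edge $e\in E$ has a success probability $p_e\in[0,1]$ and utilities $w^O_e,w^U_e,w^V_e\ge 0$ of the operator, of its offline endpoint and of its online endpoint. Each $u\in U$ and each $v\in V$ has a patience $\Delta_u,\Delta_v\in\mathbb Z^+$. When $v$ arrives, neighbours $u$ of $v$ may be probed one after the other, each at most once for this arrival; a probe of $e=(u,v)$ succeeds, independently of everything else, with probability $p_e$, and then $u$ and the arriving vertex are matched irrevocably and neither can be probed again. A vertex $u$ leaves the system after $\Delta_u$ failed probes, and an arriving vertex of type $v$ leaves after $\Delta_v$ failed probes. Let $\mathcal M$ be the set of successful matches, and $\mathcal M_u$, $\mathcal M_v$ its parts incident on $u$ and on arrivals of type $v$. The three objectives are * operator's profit: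 $\mathbb E\big[\sum_{e\in\mathcal M}w^O_e\big]$; * offline group fairness: $\min_g \mathbb E\big[\sum_{u\in U(g)}\sum_{e\in\mathcal M_u}w^U_e\big]/|U(g)|$ over the groups $g$ with $U(g)\ne\emptyset$; * online group fairness: $\min_g \mathbb E\big[\sum_{v\in V(g)}\sum_{e\in\mathcal M_v}w^V_e\big]/\sum_{v\in V(g)}n_v$ over the groups $g$ with $V(g)\neq\emptyset$. **Linear programs.** Split every type $v$ into $n_v$ copies with the same edges and data, so that each copy has one expected arrival; let $V'$ be the set of copies and $E'$ the resulting edge set. All three LPs have the constraints, for $e \in E'$, $u\in U$, $c\in V'$, $$0\le x_e\le 1,\quad \sum_{e\in E'_u}x_ep_e\le 1,\quad \sum_{e\in E'_u}x_e\le\Delta_u,\quad \sum_{e\in E'_c}x_ep_e\le 1,\quad \sum_{e\in E'_c}x_e\le\Delta_c,$$ and they maximize, respectively, $$\sum_{e\in E'}w^O_ex_ep_e,\qquad \min_{g}\frac{\sum_{u\in U(g)}\sum_{e\in E'_u}w^U_ex_ep_e}{|U(g)|},\qquad \min_g\frac{\sum_{c\in V'(g)}\sum_{e\in E'_c}w^V_ex_ep_e}{|V'(g)|}.$$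 Let $x^*,y^*,z^*$ be any optimal solutions of the three LPs. **Algorithm.** $\mathrm{PPDR}(x_c)$ rounds the vector $x_c=(x_e)_{e\in E'_c}$ to a $0/1$ vector $X_c$ by dependent rounding (repeatedly pick two fractional coordinates with values $s,t$, put $a=\min(1-s,t)$, $b=\min(s,1-t)$, and replace $(s,t)$ by $(s+a,t-a)$ with probability $b/(a+b)$ and by $(s-b,t+b)$ with probability $a/(a+b)$; a single remaining fractional coordinate of value $s$ is rounded to $1$ with probability $s$ and to $0$ otherwise). It then goes through the edges incident on the arriving vertex in a uniformly random order and probes those edges $e$ with $X_e=1$ whose offline endpoint is available, until a probe succeeds. For $\alpha,\beta,\gamma>0$ with $\alpha+\beta+\gamma\le1$, $\mathrm{TSGF}(\alpha,\beta,\gamma)$ does the following when a vertex of type $v$ arrives: it picks a uniformly random copy $c$ of $v$ and runs $\mathrm{PPDR}(x^*_c)$, $\mathrm{PPDR}(y^*_c)$ or $\mathrm{PPDR}(z^*_c)$ with probability $\alpha$, $\beta$, $\gamma$, respectively, and rejects the vertex with probability $1-(\alpha+\beta+\gamma)$. **Theorem.** For every such instance (and every $T$), $\mathrm{TSGF}(\alpha,\beta,\gamma)$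 is simultaneously $\big(\frac{\alpha}{2e},\frac{\beta}{2e},\frac{\gamma}{2e}\big)$-competitive (where $e$ is Euler's number) for the operator's profit, the offline group fairness and the online group fairness. Here $c$-competitive for an objective means that the value of the algorithm is 1. at least $c\cdot\mathbb E_I[\mathrm{OPT}(I)]$, where $I$ is the random arrival sequence and $\mathrm{OPT}(I)$ is the supremum of the objective, given $I$, over all randomized adaptive probing policies on the realized graph (which know $I$, and may probe the pairs (offline vertex, arrival) in any order, each pair at most once, subject to the matching and patience rules); and 2. at least $c$ times the value of the objective, over the random arrivals, for every policy that knows all the arrivals in advance, hence for every online policy. -/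

import Mathlib

open scoped ENNReal

set_option linter.unusedSectionVars false

namespace OnlineMatching

/-! ### Elementary randomness -/

/-- A biased coin: `true` with probability `r` (`r` is clamped to `[0, 1]`; it is only ever used
with `r ∈ [0, 1]`). -/
noncomputable def coin (r : ℝ) : PMF Bool :=
  PMF.ofFintype
    (fun b => ENNReal.ofReal (cond b (max 0 (min r 1)) (1 - max 0 (min r 1))))
    (by
      have h0 : (0 : ℝ) ≤ max 0 (min r 1) := le_max_left _ _
      have h1 : max 0 (min r 1) ≤ (1 : ℝ) := max_le zero_le_one (min_le_right _ _)
      rw [Fintype.sum_bool, cond_true, cond_false,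
        ← ENNReal.ofReal_add h0 (sub_nonneg.mpr h1)]
      simp)

/-- The law of `m` independent samples of `μ`. -/
noncomputable def iidLaw {α : Type*} [Fintype α] (μ : PMF α) (m : ℕ) : PMF (Fin m → α) :=
  PMF.ofFintype (fun a => ∏ t, μ (a t)) (by
    classical
    have h : ∑ a, μ a = 1 := by rw [← tsum_fintype (L := .unconditional _)]; exact μ.tsum_coe
    have := Finset.prod_univ_sum (fun _ : Fin m => (Finset.univ : Finset α))
      (fun _ a => μ a)
    rw [Fintype.piFinset_univ] at this
    rw [← this]
    simp [h])

/-- Expectation of a real function on a finite probability space. -/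
noncomputable def expect {α : Type*} [Fintype α] (μ : PMF α) (f : α → ℝ) : ℝ :=
  ∑ a, (μ a).toReal * f a

theorem expect_le_sum_abs {α : Type*} [Fintype α] (μ : PMF α) (f : α → ℝ) :
    expect μ f ≤ ∑ a, |f a| := by
  refine Finset.sum_le_sum fun a _ => ?_
  have h1 : (μ a).toReal ≤ 1 := by
    simpa using ENNReal.toReal_mono ENNReal.one_ne_top (μ.coe_le_one a)
  calc (μ a).toReal * f a ≤ (μ a).toReal * |f a| :=
        mul_le_mul_of_nonneg_left (le_abs_self _) ENNReal.toReal_nonneg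
    _ ≤ |f a| := mul_le_of_le_one_left (abs_nonneg _) h1

/-! ### Dependent rounding (the pairwise rounding procedure of Gandhi et al. on a star) -/

/-- The coordinate `i` of `x` is still fractional. -/
def IsFloating {ι : Type*} (x : ι → ℝ) (i : ι) : Prop := 0 < x i ∧ x i < 1

open Classical in
/-- One step of dependent rounding. If two coordinates `i ≠ j` are fractional, put
`a = min (1 - xᵢ) xⱼ` and `b = min xᵢ (1 - xⱼ)`; with probability `b / (a + b)` replace
`(xᵢ, xⱼ)` by `(xᵢ + a, xⱼ - a)`, otherwise by `(xᵢ - b, xⱼ + b)`. If exactly one coordinate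
is fractional, round it to `1` with probability equal to its value and to `0` otherwise. -/
noncomputable def roundingStep {ι : Type*} (x : ι → ℝ) : PMF (ι → ℝ) :=
  if h : ∃ q : ι × ι, q.1 ≠ q.2 ∧ IsFloating x q.1 ∧ IsFloating x q.2 then
    let i := h.choose.1
    let j := h.choose.2
    let a := min (1 - x i) (x j)
    let b := min (x i) (1 - x j)
    (coin (b / (a + b))).map fun c =>
      if c then Function.update (Function.update x i (x i + a)) j (x j - a)
      else Function.update (Function.update x i (x i - b)) j (x j + b)
  else if h : ∃ i, IsFloating x i then
    (coin (x h.choose)).map fun c => Function.update x h.choose (if c then 1 else 0)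
  else PMF.pure x

open Classical in
/-- Dependent rounding of `x ∈ [0,1]^ι`. Every step that finds a fractional coordinate makes at
least one more coordinate integral, so `card ι` steps reach a 0/1 vector. -/
noncomputable def dependentRounding {ι : Type*} [Fintype ι] (x : ι → ℝ) : PMF (ι → Bool) :=
  ((fun μ : PMF (ι → ℝ) => μ.bind roundingStep)^[Fintype.card ι] (PMF.pure x)).map
    fun y i => decide (y i = 1)

/-! ### The model -/

/-- An instance of the online matching problem with known i.i.d. arrivals: `U` is the offline
side, `V` the set of online vertex types, `𝒢` the set of group names. -/
structure KIIDInstance (U V 𝒢 : Type*) where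
  /-- edges of the bipartite graph -/
  E : Finset (U × V)
  /-- number of rounds -/
  T : ℕ
  /-- distribution of the type arriving in each round -/
  arr : PMF V
  /-- expected number of arrivals of each type, a positive integer -/
  n : V → ℕ
  n_pos : ∀ v, 0 < n v
  n_eq : ∀ v, (T : ℝ) * (arr v).toReal = n v
  /-- success probability of a probe of an edge -/
  p : U × V → ℝ
  p_nonneg : ∀ e ∈ E, 0 ≤ p e
  p_le_one : ∀ e ∈ E, p e ≤ 1
  /-- patience of the offline vertices -/
  ΔU : U → ℕ
  ΔU_pos : ∀ u, 0 < ΔU u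
  /-- patience of the online types -/
  ΔV : V → ℕ
  ΔV_pos : ∀ v, 0 < ΔV v
  /-- utility of the operator -/
  wO : U × V → ℝ
  wO_nonneg : ∀ e ∈ E, 0 ≤ wO e
  /-- utility of the offline endpoint -/
  wU : U × V → ℝ
  wU_nonneg : ∀ e ∈ E, 0 ≤ wU e
  /-- utility of the online endpoint -/
  wV : U × V → ℝ
  wV_nonneg : ∀ e ∈ E, 0 ≤ wV e
  /-- group of an offline vertex -/
  gU : U → 𝒢
  /-- group of an online type -/
  gV : V → 𝒢

namespace KIIDInstance

variable {U V 𝒢 : Type*} [Fintype U] [DecidableEq U] [Fintype V] [DecidableEq V] [DecidableEq 𝒢]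
variable (I : KIIDInstance U V 𝒢)

/-- The history of all probes so far: `(u, t, s)` records a probe between the offline vertex `u`
and the online vertex that arrived in round `t`, with `s = true` iff it was successful. -/
abbrev Hist : Type _ := List (U × Fin I.T × Bool)

/-- With history `h`, it is possible to probe `u` for the online vertex of type `v` of round `t`:
`(u, v)` is an edge, this pair was not probed before, neither vertex is matched, and
neither vertex has exhausted its patience. -/
structure CanProbe (v : V) (t : Fin I.T) (u : U) (h : I.Hist) : Prop where
  edge : (u, v) ∈ I.E
  fresh : ∀ s, (u, t, s) ∉ h
  offline_unmatched : ∀ t', (u, t', true) ∉ h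
  offline_patience : h.countP (fun q => q.1 = u ∧ q.2.2 = false) < I.ΔU u
  online_unmatched : ∀ u', (u', t, true) ∉ h
  online_patience : h.countP (fun q => q.2.1 = t ∧ q.2.2 = false) < I.ΔV v

/-- Probe `u` for the online vertex of type `v` of round `t`, and record the result. -/
noncomputable def probe (v : V) (t : Fin I.T) (u : U) (h : I.Hist) : PMF I.Hist :=
  (coin (I.p (u, v))).map fun s => (u, t, s) :: h

/-- A matching: `(u, t)` belongs to it if `u` is matched with the vertex of round `t`. -/
abbrev Matching : Type _ := Finset (U × Fin I.T)

/-- The successful matches of a history. -/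
def matched (h : I.Hist) : I.Matching :=
  ((h.filter fun q => q.2.2).map fun q => (q.1, q.2.1)).toFinset

/-- A sequence of arriving types together with the final matching. -/
abbrev Outcome : Type _ := (Fin I.T → V) × I.Matching

/-- The law of the arrival sequence: independent rounds, each with law `arr`. -/
noncomputable def arrivals : PMF (Fin I.T → V) := iidLaw I.arr I.T

/-- If `L a` is the law of the matching made by some algorithm when the arrival sequence is `a`,
this is the joint law of arrivals and matching. -/
noncomputable def joint (L : (Fin I.T → V) → PMF I.Matching) : PMF I.Outcome :=
  I.arrivals.bind fun a => (L a).map fun M => (a, M)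

/-! ### The three objectives, as functions of the law of the outcome -/

/-- The operator's expected profit. -/
noncomputable def profit (P : PMF I.Outcome) : ℝ :=
  expect P fun ω => ∑ e ∈ ω.2, I.wO (e.1, ω.1 e.2)

/-- The average expected utility of the offline vertices of the group `g`. -/
noncomputable def offlineGroup (P : PMF I.Outcome) (g : 𝒢) : ℝ :=
  expect P (fun ω => ∑ u with I.gU u = g, ∑ e ∈ ω.2 with e.1 = u, I.wU (e.1, ω.1 e.2)) /
    (Finset.univ.filter fun u => I.gU u = g).card

/-- The average expected utility of the online types of the group `g`. -/
noncomputable def onlineGroup (P : PMF I.Outcome) (g : 𝒢) : ℝ :=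
  expect P (fun ω => ∑ v with I.gV v = g, ∑ e ∈ ω.2 with ω.1 e.2 = v, I.wV (e.1, ω.1 e.2)) /
    ∑ v with I.gV v = g, (I.n v : ℝ)

/-- Offline Rawlsian group fairness: the minimum is over the groups that occur in `U`. -/
noncomputable def offlineFairness [Nonempty U] (P : PMF I.Outcome) : ℝ :=
  (Finset.univ.image I.gU).inf' (Finset.univ_nonempty.image _) (I.offlineGroup P)

/-- Online Rawlsian group fairness: the minimum is over the groups that occur in `V`. -/
noncomputable def onlineFairness [Nonempty V] (P : PMF I.Outcome) : ℝ :=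
  (Finset.univ.image I.gV).inf' (Finset.univ_nonempty.image _) (I.onlineGroup P)

/-! ### The benchmark: arbitrary probing policies on a realized instance -/

/-- A randomized adaptive probing policy: from the history so far it chooses the next pair
(offline vertex, round) to be probed, or stops. -/
abbrev Policy : Type _ := I.Hist → PMF (Option (U × Fin I.T))

open Classical in
/-- Run a policy for at most `k` probes when the arrival sequence is `a`; the run ends when
the policy stops or asks for a probe that is not possible. -/
noncomputable def runPolicy (a : Fin I.T → V) (σ : I.Policy) : ℕ → I.Hist → PMF I.Hist
  | 0, h => PMF.pure h
  | k + 1, h => (σ h).bind fun o =>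
      match o with
      | none => PMF.pure h
      | some (u, t) =>
          if I.CanProbe (a t) t u h then (I.probe (a t) t u h).bind (runPolicy a σ k)
          else PMF.pure h

/-- The law of the matching made by a policy when the arrival sequence is `a`. Every pair is
probed at most once, so that `card U * T` probes are enough. -/
noncomputable def policyLaw (a : Fin I.T → V) (σ : I.Policy) : PMF I.Matching :=
  (I.runPolicy a σ (Fintype.card U * I.T) []).map I.matched

/-- `OPT(a)`: the optimal value of the objective on the realized arrival sequence `a`, over all
policies, which may know `a` and may probe the pairs in any order. -/
noncomputable def optAt (obj : PMF I.Outcome → ℝ) (a : Fin I.T → V) : ℝ :=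
  ⨆ σ : I.Policy, obj ((I.policyLaw a σ).map fun M => (a, M))

/-- The expectation of `OPT(a)` over the arrival sequence `a`. -/
noncomputable def opt (obj : PMF I.Outcome → ℝ) : ℝ :=
  expect I.arrivals (I.optAt obj)

/-- An algorithm (given through the law `L a` of its matching on each arrival sequence `a`)
is `c`-competitive for the objective `obj` on the instance `I`: it achieves at least `c` times
the expected optimum of the realized instance, and at least `c` times the value of `obj`
attained by any policy that knows all arrivals in advance (hence by any online policy). -/
def IsCompetitive (obj : PMF I.Outcome → ℝ) (c : ℝ) (L : (Fin I.T → V) → PMF I.Matching) :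
    Prop :=
  c * I.opt obj ≤ obj (I.joint L) ∧
    ∀ σ : (Fin I.T → V) → I.Policy,
      c * obj (I.joint fun a => I.policyLaw a (σ a)) ≤ obj (I.joint L)

/-! The three objectives are bounded, so that the suprema in `optAt` are genuine. -/

theorem bddAbove_profit : BddAbove (Set.range I.profit) :=
  ⟨_, by rintro _ ⟨P, rfl⟩; exact expect_le_sum_abs _ _⟩

theorem bddAbove_offlineFairness [Nonempty U] : BddAbove (Set.range I.offlineFairness) := by
  obtain ⟨g, hg⟩ := (Finset.univ_nonempty (α := U)).image I.gU
  refine ⟨?w, ?_⟩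
  swap
  rintro _ ⟨P, rfl⟩
  refine (Finset.inf'_le _ hg).trans ?_
  unfold offlineGroup
  exact div_le_div_of_nonneg_right (expect_le_sum_abs P _) (Nat.cast_nonneg _)

theorem bddAbove_onlineFairness [Nonempty V] : BddAbove (Set.range I.onlineFairness) := by
  obtain ⟨g, hg⟩ := (Finset.univ_nonempty (α := V)).image I.gV
  refine ⟨?w, ?_⟩
  swap
  rintro _ ⟨P, rfl⟩
  refine (Finset.inf'_le _ hg).trans ?_
  unfold onlineGroup
  exact div_le_div_of_nonneg_right (expect_le_sum_abs P _)
    (Finset.sum_nonneg fun _ _ => Nat.cast_nonneg _)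

/-! ### The linear programs

Every type `v` is split into `n v` copies, each with expected number of arrivals one. -/

/-- The copies of the online types. -/
abbrev Copy : Type _ := Σ v : V, Fin (I.n v)

/-- The pairs (offline vertex, copy of a type) that are edges. -/
def copyEdges : Finset (U × I.Copy) :=
  Finset.univ.filter fun e => (e.1, e.2.1) ∈ I.E

/-- The constraints common to the three linear programs. -/
structure LPFeasible (x : U × I.Copy → ℝ) : Prop where
  nonneg : ∀ e ∈ I.copyEdges, 0 ≤ x e
  le_one : ∀ e ∈ I.copyEdges, x e ≤ 1
  offline_capacity : ∀ u, ∑ e ∈ I.copyEdges with e.1 = u, x e * I.p (e.1, e.2.1) ≤ 1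
  offline_patience : ∀ u, ∑ e ∈ I.copyEdges with e.1 = u, x e ≤ I.ΔU u
  online_capacity : ∀ c, ∑ e ∈ I.copyEdges with e.2 = c, x e * I.p (e.1, e.2.1) ≤ 1
  online_patience : ∀ c, ∑ e ∈ I.copyEdges with e.2 = c, x e ≤ I.ΔV c.1

/-- Objective of the operator's program. -/
noncomputable def lpProfit (x : U × I.Copy → ℝ) : ℝ :=
  ∑ e ∈ I.copyEdges, I.wO (e.1, e.2.1) * x e * I.p (e.1, e.2.1)

/-- Objective of the offline fairness program. -/
noncomputable def lpOffline [Nonempty U] (x : U × I.Copy → ℝ) : ℝ :=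
  (Finset.univ.image I.gU).inf' (Finset.univ_nonempty.image _) fun g =>
    (∑ u with I.gU u = g, ∑ e ∈ I.copyEdges with e.1 = u,
      I.wU (e.1, e.2.1) * x e * I.p (e.1, e.2.1)) /
      (Finset.univ.filter fun u => I.gU u = g).card

/-- Objective of the online fairness program. -/
noncomputable def lpOnline [Nonempty V] (x : U × I.Copy → ℝ) : ℝ :=
  (Finset.univ.image I.gV).inf' (Finset.univ_nonempty.image _) fun g =>
    (∑ c : I.Copy with I.gV c.1 = g, ∑ e ∈ I.copyEdges with e.2 = c,
      I.wV (e.1, e.2.1) * x e * I.p (e.1, e.2.1)) /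
      (Finset.univ.filter fun c : I.Copy => I.gV c.1 = g).card

/-- `x` is an optimal solution of the linear program with the given objective. -/
def IsOptimalLP (obj : (U × I.Copy → ℝ) → ℝ) (x : U × I.Copy → ℝ) : Prop :=
  I.LPFeasible x ∧ ∀ y, I.LPFeasible y → obj y ≤ obj x

/-! ### The algorithm -/

/-- The neighbours of the type `v` (its incident edges). -/
abbrev Nbr (v : V) : Type _ := {u : U // (u, v) ∈ I.E}

open Classical in
/-- The probing loop: go through the neighbours in the given order and probe those which are
available and were selected by the rounding. (After a success the arriving vertex is matched,
so `CanProbe` fails for all later neighbours.) -/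
noncomputable def probeLoop (v : V) (t : Fin I.T) (X : I.Nbr v → Bool) :
    List (I.Nbr v) → I.Hist → PMF I.Hist
  | [], h => PMF.pure h
  | u :: l, h =>
      if X u = true ∧ I.CanProbe v t u.1 h then
        (I.probe v t u.1 h).bind (probeLoop v t X l)
      else probeLoop v t X l h

/-- `PPDR`: round the vector dependently, choose a uniformly random order of the incident edges,
and run the probing loop. -/
noncomputable def ppdr (v : V) (t : Fin I.T) (x : I.Nbr v → ℝ) (h : I.Hist) : PMF I.Hist :=
  (dependentRounding x).bind fun X =>
    (PMF.uniformOfFintype (Equiv.Perm (I.Nbr v))).bind fun π =>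
      I.probeLoop v t X (Finset.univ.toList.map π) h

/-- The choice made in each round: the solution with index `0`, `1`, `2` with probability
`α`, `β`, `γ`, and rejection otherwise. -/
noncomputable def choice (α β γ : ℝ) (hα : 0 < α) (hβ : 0 < β) (hγ : 0 < γ)
    (hs : α + β + γ ≤ 1) : PMF (Option (Fin 3)) :=
  PMF.ofFintype
    (fun o => ENNReal.ofReal (o.elim (1 - (α + β + γ)) ![α, β, γ]))
    (by
      rw [Fintype.sum_option, Fin.sum_univ_three]
      simp only [Option.elim, Matrix.cons_val]
      rw [← ENNReal.ofReal_add hα.le hβ.le, ← ENNReal.ofReal_add (by positivity) hγ.le,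
        ← ENNReal.ofReal_add (by linarith) (by positivity)]
      simp)

/-- One round of `TSGF`, when a vertex of type `v` arrives in round `t`: pick a uniformly random
copy of `v` and choose one of the three LP solutions (or reject) according to `q`; then run
`PPDR` on the part of the chosen solution that belongs to the picked copy. -/
noncomputable def tsgfRound (q : PMF (Option (Fin 3))) (s : Fin 3 → U × I.Copy → ℝ)
    (v : V) (t : Fin I.T) (h : I.Hist) : PMF I.Hist :=
  haveI : Nonempty (Fin (I.n v)) := ⟨⟨0, I.n_pos v⟩⟩
  (PMF.uniformOfFintype (Fin (I.n v))).bind fun k =>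
    q.bind fun o =>
      match o with
      | none => PMF.pure h
      | some i => I.ppdr v t (fun u => s i (u.1, ⟨v, k⟩)) h

/-- `TSGF(α, β, γ)` with the LP solutions `x`, `y`, `z`: the law of its matching on each arrival
sequence `a`. The rounds are treated in their order, and round `t` uses only `a t` and
the history. -/
noncomputable def tsgf (α β γ : ℝ) (hα : 0 < α) (hβ : 0 < β) (hγ : 0 < γ)
    (hs : α + β + γ ≤ 1) (x y z : U × I.Copy → ℝ) (a : Fin I.T → V) : PMF I.Matching :=
  ((List.finRange I.T).foldl
    (fun μ t => μ.bind (I.tsgfRound (choice α β γ hα hβ hγ hs) ![x, y, z] (a t) t))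
    (PMF.pure [])).map I.matched

end KIIDInstance

end OnlineMatching

/-! Each of the three objectives is a minimum of scaled linear functionals of the matching, of the
form `weight w`; the profit is the case of a single functional. The proof has an upper bound for
policies and a lower bound for the algorithm, both for arbitrary edge weights.

Upper bound. For a policy that knows the arrivals, spread the expected number of probes between `u`
and type `v` evenly over the copies of `v`. The result satisfies the LP constraints
(`policySolution_feasible`), because every run obeys the matching and patience rules. Its LP value
equals the policy's value for all weights at once (`weight_joint_policyLaw`), since a probe succeeds
independently of the decision to make it. Hence a minimum over groups is also bounded by the LP
optimum. As an average of minima is at most the minimum of the averages, the bound passes to the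
expected realized optimum.

Lower bound. If `u` is available when a round starts, the round yields for `u` at least `1 / (2T)`
of its LP load, times the probability of choosing that LP (`le_ev_round_matched`). The half comes
from three facts: rounding selects `u` with probability `x u`, pairs of selections are negatively
correlated, and a competitor precedes `u` in the random order with probability at most one half.
Since rounding preserves integral bounds on the sum, the arriving vertex never lacks patience for a
selected edge.

Availability is controlled by a potential. Whatever mixture of the three LPs is used, in a round `u`
is matched with probability at most `1 / T` and suffers at most `ΔU u / T` failed probes on average.
With `r = 1 - 1/T`, the function `r^j (1 - fails/ΔU) - (j/T) r^(j-1)`, truncated at zero and set to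
zero once `u` is matched, therefore bounds from below the probability of availability after `j` more
rounds (`potential_zero_le`, `potential_succ_le_ev_round`). Summed over `j < T` from the empty
history it telescopes to at least `T r^(T-1) ≥ T / e` (`sum_potential_nil`). Multiplying by the gain
per available round gives `1 / (2e)` (`le_ev_gain`, `le_weight_joint_runRounds`). -/

namespace OnlineMatching

/-! ### Expectation under a finitely supported law -/

/-- Expectation of a real function under a law on an arbitrary type. -/
noncomputable def ev {α : Type*} (μ : PMF α) (f : α → ℝ) : ℝ := ∑' a, (μ a).toReal * f a

section ev

variable {α β : Type*}

theorem ev_eq_sum {μ : PMF α} {S : Finset α} (h : μ.support ⊆ S) (f : α → ℝ) :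
    ev μ f = ∑ a ∈ S, (μ a).toReal * f a := by
  refine tsum_eq_sum fun a ha => ?_
  have : μ a = 0 := by
    by_contra h0
    exact ha (h ((μ.mem_support_iff a).2 h0))
  simp [this]

theorem expect_eq_ev [Fintype α] (μ : PMF α) (f : α → ℝ) : expect μ f = ev μ f :=
  (ev_eq_sum (by simp) f).symm

theorem ev_fintype [Fintype α] (μ : PMF α) (f : α → ℝ) : ev μ f = ∑ a, (μ a).toReal * f a :=
  ev_eq_sum (by simp) f

@[simp] theorem ev_pure (a : α) (f : α → ℝ) : ev (PMF.pure a) f = f a := by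
  rw [ev_eq_sum (S := {a}) (by simp)]
  simp

theorem finite_support_pure (a : α) : (PMF.pure a).support.Finite := by simp

theorem finite_support_bind {μ : PMF α} {k : α → PMF β} (hμ : μ.support.Finite)
    (hk : ∀ a ∈ μ.support, (k a).support.Finite) : (μ.bind k).support.Finite := by
  rw [PMF.support_bind]
  exact hμ.biUnion hk

theorem finite_support_map {μ : PMF α} (hμ : μ.support.Finite) (g : α → β) :
    (μ.map g).support.Finite := by
  rw [PMF.support_map]
  exact hμ.image g

/-- Finite support replaces integrability: histories and real vectors form infinite types, but every
law in the argument charges finitely many points, so that this is an exchange of finite sums. -/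
theorem ev_bind {μ : PMF α} {k : α → PMF β} (hμ : μ.support.Finite)
    (hk : ∀ a ∈ μ.support, (k a).support.Finite) (f : β → ℝ) :
    ev (μ.bind k) f = ev μ fun a => ev (k a) f := by
  classical
  have hb := finite_support_bind hμ hk
  rw [ev_eq_sum (S := hb.toFinset) (by simp), ev_eq_sum (S := hμ.toFinset) (by simp)]
  have h1 : ∀ a ∈ hμ.toFinset, (μ a).toReal * ev (k a) f =
      ∑ b ∈ hb.toFinset, (μ a).toReal * ((k a b).toReal * f b) := by
    intro a ha
    rw [ev_eq_sum (S := hb.toFinset), Finset.mul_sum]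
    intro b hb'
    rw [Set.Finite.coe_toFinset, PMF.support_bind]
    exact Set.mem_biUnion (by simpa using ha) hb'
  rw [Finset.sum_congr rfl h1, Finset.sum_comm]
  refine Finset.sum_congr rfl fun b _ => ?_
  rw [PMF.bind_apply, tsum_eq_sum (s := hμ.toFinset), ENNReal.toReal_sum, Finset.sum_mul]
  · exact Finset.sum_congr rfl fun a _ => by rw [ENNReal.toReal_mul]; ring
  · exact fun a _ => ENNReal.mul_ne_top (μ.apply_ne_top a) ((k a).apply_ne_top b)
  · intro a ha
    have : μ a = 0 := by
      by_contra h0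
      exact ha (by simpa using h0)
    simp [this]

theorem ev_map {μ : PMF α} (hμ : μ.support.Finite) (g : α → β) (f : β → ℝ) :
    ev (μ.map g) f = ev μ fun a => f (g a) := by
  rw [PMF.map, ev_bind (k := PMF.pure ∘ g) hμ (fun a _ => finite_support_pure _)]
  simp

theorem ev_mono {μ : PMF α} (hμ : μ.support.Finite) {f g : α → ℝ}
    (h : ∀ a ∈ μ.support, f a ≤ g a) : ev μ f ≤ ev μ g := by
  rw [ev_eq_sum (S := hμ.toFinset) (by simp), ev_eq_sum (S := hμ.toFinset) (by simp)]
  exact Finset.sum_le_sum fun a ha =>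
    mul_le_mul_of_nonneg_left (h a (by simpa using ha)) ENNReal.toReal_nonneg

theorem ev_congr {μ : PMF α} (hμ : μ.support.Finite) {f g : α → ℝ}
    (h : ∀ a ∈ μ.support, f a = g a) : ev μ f = ev μ g :=
  le_antisymm (ev_mono hμ fun a ha => (h a ha).le) (ev_mono hμ fun a ha => (h a ha).ge)

theorem ev_const_mul (μ : PMF α) (c : ℝ) (f : α → ℝ) :
    (ev μ fun a => c * f a) = c * ev μ f := by
  unfold ev
  rw [← tsum_mul_left]
  exact tsum_congr fun a => by ring

theorem ev_mul_const (μ : PMF α) (c : ℝ) (f : α → ℝ) :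
    (ev μ fun a => f a * c) = ev μ f * c := by
  unfold ev
  rw [← tsum_mul_right]
  exact tsum_congr fun a => by ring

theorem ev_add {μ : PMF α} (hμ : μ.support.Finite) (f g : α → ℝ) :
    (ev μ fun a => f a + g a) = ev μ f + ev μ g := by
  have hS : μ.support ⊆ hμ.toFinset := by simp
  simp only [ev_eq_sum hS, mul_add, Finset.sum_add_distrib]

theorem ev_sub {μ : PMF α} (hμ : μ.support.Finite) (f g : α → ℝ) :
    (ev μ fun a => f a - g a) = ev μ f - ev μ g := by
  have hS : μ.support ⊆ hμ.toFinset := by simp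
  simp only [ev_eq_sum hS, mul_sub, Finset.sum_sub_distrib]

theorem ev_sum {ι : Type*} {μ : PMF α} (hμ : μ.support.Finite) (s : Finset ι)
    (f : ι → α → ℝ) : (ev μ fun a => ∑ i ∈ s, f i a) = ∑ i ∈ s, ev μ (f i) := by
  have hS : μ.support ⊆ hμ.toFinset := by simp
  simp only [ev_eq_sum hS, Finset.mul_sum]
  exact Finset.sum_comm

@[simp] theorem ev_const (μ : PMF α) (c : ℝ) : (ev μ fun _ => c) = c := by
  unfold ev
  rw [tsum_mul_right, ← ENNReal.tsum_toReal_eq μ.apply_ne_top, μ.tsum_coe]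
  simp

theorem ev_nonneg {μ : PMF α} (hμ : μ.support.Finite) {f : α → ℝ}
    (h : ∀ a ∈ μ.support, 0 ≤ f a) : 0 ≤ ev μ f := by
  simpa using ev_mono hμ h

theorem ev_le_of_le {μ : PMF α} (hμ : μ.support.Finite) {f : α → ℝ} {c : ℝ}
    (h : ∀ a ∈ μ.support, f a ≤ c) : ev μ f ≤ c := by
  simpa using ev_mono hμ h

theorem ev_comm {μ : PMF α} {ν : PMF β} (hμ : μ.support.Finite) (hν : ν.support.Finite)
    (f : α → β → ℝ) : (ev μ fun a => ev ν fun b => f a b) = ev ν fun b => ev μ fun a => f a b := by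
  have hS : μ.support ⊆ hμ.toFinset := by simp
  have hR : ν.support ⊆ hν.toFinset := by simp
  simp only [ev_eq_sum hS, ev_eq_sum hR, Finset.mul_sum]
  rw [Finset.sum_comm]
  exact Finset.sum_congr rfl fun b _ => Finset.sum_congr rfl fun a _ => by ring

theorem ev_coin {r : ℝ} (h0 : 0 ≤ r) (h1 : r ≤ 1) (f : Bool → ℝ) :
    ev (coin r) f = r * f true + (1 - r) * f false := by
  rw [ev_fintype, Fintype.sum_bool]
  simp [coin, h0, h1]

theorem ev_uniformOfFintype [Fintype α] [Nonempty α] (f : α → ℝ) :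
    ev (PMF.uniformOfFintype α) f = (Fintype.card α : ℝ)⁻¹ * ∑ a, f a := by
  rw [ev_fintype, Finset.mul_sum]
  simp

end ev

/-! ### Independent samples -/

/-- A coordinate of an independent sample can be drawn anew. -/
theorem ev_iidLaw_resample {α : Type*} [Fintype α] (μ : PMF α) {m : ℕ} (t : Fin m)
    (F : (Fin m → α) → ℝ) :
    ev (iidLaw μ m) F = ev (iidLaw μ m) fun a => ev μ fun v => F (Function.update a t v) := by
  classical
  have hμ : ∑ v, (μ v).toReal = 1 := by simpa [ev_fintype] using ev_const μ 1
  have hw : ∀ a : Fin m → α, (iidLaw μ m a).toReal =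
      (μ (a t)).toReal * ∏ i : {i // i ≠ t}, (μ (a i)).toReal := by
    intro a
    rw [iidLaw, PMF.ofFintype_apply, ENNReal.toReal_prod,
      ← Finset.mul_prod_erase _ _ (Finset.mem_univ t)]
    congr 1
    exact (Finset.prod_subtype _ (by simp) _)
  simp only [ev_fintype, hw]
  rw [← (Equiv.funSplitAt t α).symm.sum_comp, ← (Equiv.funSplitAt t α).symm.sum_comp,
    Fintype.sum_prod_type, Fintype.sum_prod_type_right]
  have hup : ∀ (v v' : α) (r : {i // i ≠ t} → α),
      Function.update ((Equiv.funSplitAt t α).symm (v, r)) t v' =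
        (Equiv.funSplitAt t α).symm (v', r) := by
    intro v v' r
    ext i
    by_cases h : i = t <;> simp [Equiv.funSplitAt, Equiv.piSplitAt, h]
  have hat : ∀ (v : α) (r : {i // i ≠ t} → α), (Equiv.funSplitAt t α).symm (v, r) t = v := by
    intro v r; simp [Equiv.funSplitAt, Equiv.piSplitAt]
  have hne : ∀ (v : α) (r : {i // i ≠ t} → α) (i : {i // i ≠ t}),
      (Equiv.funSplitAt t α).symm (v, r) i = r i := by
    intro v r i; simp [Equiv.funSplitAt, Equiv.piSplitAt, i.2]
  simp only [hup, hat, hne]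
  rw [Finset.sum_comm]
  refine Finset.sum_congr rfl fun r _ => ?_
  simp only [mul_assoc]
  rw [← Finset.sum_mul, hμ, one_mul, Finset.mul_sum]
  exact Finset.sum_congr rfl fun v _ => by ring

/-! ### Dependent rounding -/

section rounding

variable {ι : Type*}

open Classical in
-- Hides the chosen coordinates behind existentials: nothing later depends on which floating pair is
-- picked.
theorem roundingStep_cases (x : ι → ℝ) :
    (∃ i j, i ≠ j ∧ IsFloating x i ∧ IsFloating x j ∧ ∃ a b, a = min (1 - x i) (x j) ∧
      b = min (x i) (1 - x j) ∧ roundingStep x = (coin (b / (a + b))).map fun c =>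
        if c then Function.update (Function.update x i (x i + a)) j (x j - a)
        else Function.update (Function.update x i (x i - b)) j (x j + b)) ∨
    ((∀ i j, IsFloating x i → IsFloating x j → i = j) ∧ ∃ i, IsFloating x i ∧
      roundingStep x = (coin (x i)).map fun c => Function.update x i (if c then 1 else 0)) ∨
    ((∀ i, ¬ IsFloating x i) ∧ roundingStep x = PMF.pure x) := by
  by_cases h : ∃ q : ι × ι, q.1 ≠ q.2 ∧ IsFloating x q.1 ∧ IsFloating x q.2
  · left
    refine ⟨h.choose.1, h.choose.2, h.choose_spec.1, h.choose_spec.2.1, h.choose_spec.2.2,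
      _, _, rfl, rfl, ?_⟩
    rw [roundingStep, dif_pos h]
  · have hu : ∀ i j, IsFloating x i → IsFloating x j → i = j := by
      intro i j hi hj
      by_contra hij
      exact h ⟨(i, j), hij, hi, hj⟩
    by_cases h' : ∃ i, IsFloating x i
    · right; left
      refine ⟨hu, h'.choose, h'.choose_spec, ?_⟩
      rw [roundingStep, dif_neg h, dif_pos h']
    · right; right
      refine ⟨fun i hi => h' ⟨i, hi⟩, ?_⟩
      rw [roundingStep, dif_neg h, dif_neg h']

theorem finite_support_roundingStep (x : ι → ℝ) : (roundingStep x).support.Finite := by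
  rcases roundingStep_cases x with ⟨i, j, -, -, -, a, b, -, -, h⟩ | ⟨-, i, -, h⟩ | ⟨-, h⟩
  · rw [h]; exact finite_support_map (Set.toFinite _) _
  · rw [h]; exact finite_support_map (Set.toFinite _) _
  · rw [h]; exact finite_support_pure _

/-- The amounts moved by a step on two floating coordinates of values `s` and `t`. -/
theorem roundingStep_amounts {s t a b : ℝ} (hs : 0 < s ∧ s < 1) (ht : 0 < t ∧ t < 1)
    (ha : a = min (1 - s) t) (hb : b = min s (1 - t)) :
    0 < a ∧ 0 < b ∧ a ≤ 1 - s ∧ a ≤ t ∧ b ≤ s ∧ b ≤ 1 - t ∧ 0 ≤ b / (a + b) ∧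
      b / (a + b) ≤ 1 ∧ b / (a + b) * a = (1 - b / (a + b)) * b := by
  have ha0 : 0 < a := by rw [ha]; exact lt_min (by linarith) ht.1
  have hb0 : 0 < b := by rw [hb]; exact lt_min hs.1 (by linarith)
  refine ⟨ha0, hb0, ha ▸ min_le_left _ _, ha ▸ min_le_right _ _, hb ▸ min_le_left _ _,
    hb ▸ min_le_right _ _, by positivity, ?_, ?_⟩
  · rw [div_le_one (by positivity)]; linarith
  · field_simp; ring

/-- The coin is biased so that the mean upward and downward moves cancel, `r * a = (1 - r) * b`. -/
theorem ev_roundingStep_apply (x : ι → ℝ) (k : ι) : (ev (roundingStep x) fun y => y k) = x k := by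
  classical
  rcases roundingStep_cases x with ⟨i, j, hij, hi, hj, a, b, ha, hb, h⟩ | ⟨-, i, hi, h⟩ | ⟨-, h⟩
  · obtain ⟨-, -, -, -, -, -, h0, h1, hab⟩ := roundingStep_amounts hi hj ha hb
    rw [h, ev_map (Set.toFinite _), ev_coin h0 h1]
    by_cases hkj : k = j
    · subst hkj; simp; linear_combination -hab
    · by_cases hki : k = i
      · subst hki; simp [hkj]; linear_combination hab
      · simp [hkj, hki]; ring
  · rw [h, ev_map (Set.toFinite _), ev_coin hi.1.le hi.2.le]
    by_cases hki : k = i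
    · subst hki; simp
    · simp [hki]; ring
  · rw [h, ev_pure]

/-- The two moving coordinates move in opposite directions, so their product loses a variance term
on average. If at most one of `k`, `l` moves, the product keeps its mean. -/
theorem ev_roundingStep_mul_le (x : ι → ℝ) {k l : ι} (hkl : k ≠ l) :
    (ev (roundingStep x) fun y => y k * y l) ≤ x k * x l := by
  classical
  rcases roundingStep_cases x with ⟨i, j, hij, hi, hj, a, b, ha, hb, h⟩ | ⟨-, i, hi, h⟩ | ⟨-, h⟩
  · obtain ⟨ha0, hb0, -, -, -, -, h0, h1, hab⟩ := roundingStep_amounts hi hj ha hb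
    rw [h, ev_map (Set.toFinite _), ev_coin h0 h1]
    set r := b / (a + b)
    have key : r * ((x i + a) * (x j - a)) + (1 - r) * ((x i - b) * (x j + b)) ≤ x i * x j := by
      have h2 : r * ((x i + a) * (x j - a)) + (1 - r) * ((x i - b) * (x j + b)) =
          x i * x j - r * a ^ 2 - (1 - r) * b ^ 2 := by
        linear_combination (x j - x i) * hab
      have := mul_nonneg h0 (sq_nonneg a)
      have := mul_nonneg (sub_nonneg.2 h1) (sq_nonneg b)
      linarith
    by_cases hki : k = i
    · subst hki
      by_cases hlj : l = j
      · subst hlj; simpa [hij] using key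
      · simp [hij, hlj, hkl.symm]
        exact le_of_eq (by linear_combination x l * hab)
    · by_cases hkj : k = j
      · subst hkj
        by_cases hli : l = i
        · subst hli
          simp [hkl.symm]
          linarith
        · simp [hkl.symm, hli]
          exact le_of_eq (by linear_combination -x l * hab)
      · by_cases hli : l = i
        · subst hli
          simp [hki, hkj, hij]
          exact le_of_eq (by linear_combination x k * hab)
        · by_cases hlj : l = j
          · subst hlj
            simp [hki, hkj]
            exact le_of_eq (by linear_combination -x k * hab)
          · simp [hki, hkj, hli, hlj]
            exact le_of_eq (by ring)
  · rw [h, ev_map (Set.toFinite _), ev_coin hi.1.le hi.2.le]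
    by_cases hki : k = i
    · subst hki; simp [hkl.symm]
    · by_cases hli : l = i
      · subst hli; simp [hki]; exact le_of_eq (by ring)
      · simp [hki, hli]; exact le_of_eq (by ring)
  · rw [h, ev_pure]

variable [Fintype ι]

open Classical in
/-- Each step keeps the vector in the unit cube, keeps an integral bound on the sum, and lowers
the number of floating coordinates. -/
theorem roundingStep_invariant {x : ι → ℝ} {N m : ℕ} (hx : ∀ i, 0 ≤ x i ∧ x i ≤ 1)
    (hN : ∑ i, x i ≤ N) (hm : (Finset.univ.filter (IsFloating x)).card ≤ m + 1)
    {y : ι → ℝ} (hy : y ∈ (roundingStep x).support) :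
    (∀ i, 0 ≤ y i ∧ y i ≤ 1) ∧ ∑ i, y i ≤ N ∧
      (Finset.univ.filter (IsFloating y)).card ≤ m := by
  have drop : ∀ (y : ι → ℝ) (k : ι), IsFloating x k → ¬ IsFloating y k →
      (∀ l, IsFloating y l → IsFloating x l) →
      (Finset.univ.filter (IsFloating y)).card ≤ m := by
    intro y k hk hyk hl
    have : (Finset.univ.filter (IsFloating y)).card <
        (Finset.univ.filter (IsFloating x)).card := by
      refine Finset.card_lt_card ?_
      rw [Finset.ssubset_iff_of_subset]
      · exact ⟨k, by simpa using hk, by simpa using hyk⟩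
      · intro l; simpa using hl l
    omega
  rcases roundingStep_cases x with ⟨i, j, hij, hi, hj, a, b, ha, hb, h⟩ | ⟨hu, i, hi, h⟩ | ⟨hn, h⟩
  · obtain ⟨ha0, hb0, ha1, ha2, hb1, hb2, h0, h1, hab⟩ := roundingStep_amounts hi hj ha hb
    have pair : ∀ s t : ℝ, s + t = x i + x j → 0 ≤ s → s ≤ 1 → 0 ≤ t → t ≤ 1 →
        (¬ (0 < s ∧ s < 1) ∨ ¬ (0 < t ∧ t < 1)) →
        (∀ l, 0 ≤ Function.update (Function.update x i s) j t l ∧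
          Function.update (Function.update x i s) j t l ≤ 1) ∧
        ∑ l, Function.update (Function.update x i s) j t l ≤ N ∧
        (Finset.univ.filter
          (IsFloating (Function.update (Function.update x i s) j t))).card ≤ m := by
      intro s t hst hs0 hs1 ht0 ht1 hor
      set z := Function.update (Function.update x i s) j t with hz
      have hzi : z i = s := by simp [hz, hij]
      have hzj : z j = t := by simp [hz]
      have hzl : ∀ l, l ≠ i → l ≠ j → z l = x l := by
        intro l hli hlj; simp [hz, hli, hlj]
      refine ⟨?_, ?_, ?_⟩
      · intro l
        by_cases hli : l = i
        · subst hli; rw [hzi]; exact ⟨hs0, hs1⟩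
        by_cases hlj : l = j
        · subst hlj; rw [hzj]; exact ⟨ht0, ht1⟩
        rw [hzl l hli hlj]; exact hx l
      · have e : ∀ f : ι → ℝ, ∑ l, f l =
            f i + (f j + ∑ l ∈ (Finset.univ.erase i).erase j, f l) := by
          intro f
          rw [Finset.add_sum_erase _ _ (by simp [hij.symm]), Finset.add_sum_erase _ _ (by simp)]
        have e2 : ∑ l ∈ (Finset.univ.erase i).erase j, z l =
            ∑ l ∈ (Finset.univ.erase i).erase j, x l := by
          refine Finset.sum_congr rfl fun l hl => hzl l ?_ ?_ <;> simp at hl <;> tauto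
        rw [e z, hzi, hzj, e2]
        rw [e x] at hN
        linarith
      · have hfl : ∀ l, IsFloating z l → IsFloating x l := by
          intro l hl
          by_cases hli : l = i
          · subst hli; exact hi
          by_cases hlj : l = j
          · subst hlj; exact hj
          unfold IsFloating at hl
          rwa [hzl l hli hlj] at hl
        rcases hor with hor | hor
        · exact drop z i hi (by unfold IsFloating; rwa [hzi]) hfl
        · exact drop z j hj (by unfold IsFloating; rwa [hzj]) hfl
    rw [h, PMF.support_map] at hy
    obtain ⟨c, -, rfl⟩ := hy
    cases c
    · simp only [Bool.false_eq_true, if_false]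
      refine pair _ _ (by ring) (by linarith) (by linarith [hi.2]) (by linarith [hj.1])
        (by linarith) ?_
      -- `b` attains one of its two bounds, so either coordinate `i` reaches 0 or coordinate `j`
      -- reaches 1.
      rcases min_choice (x i) (1 - x j) with hc | hc <;> rw [hc] at hb
      · left; rintro ⟨hl, -⟩; linarith
      · right; rintro ⟨-, hl⟩; linarith
    · simp only [if_true]
      refine pair _ _ (by ring) (by linarith [hi.1]) (by linarith) (by linarith)
        (by linarith [hj.2]) ?_
      rcases min_choice (1 - x i) (x j) with hc | hc <;> rw [hc] at ha
      · left; rintro ⟨-, hl⟩; linarith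
      · right; rintro ⟨hl, -⟩; linarith
  · rw [h, PMF.support_map] at hy
    obtain ⟨c, -, rfl⟩ := hy
    have hs01 : (if c = true then (1 : ℝ) else 0) = 0 ∨ (if c = true then (1 : ℝ) else 0) = 1 := by
      split_ifs <;> simp
    suffices key : ∀ s : ℝ, s = 0 ∨ s = 1 → (∀ l, 0 ≤ Function.update x i s l ∧
        Function.update x i s l ≤ 1) ∧ ∑ l, Function.update x i s l ≤ N ∧
        (Finset.univ.filter (IsFloating (Function.update x i s))).card ≤ m from key _ hs01
    clear hs01
    intro s hs01
    refine ⟨?_, ?_, ?_⟩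
    · intro l
      by_cases hli : l = i
      · subst hli; rcases hs01 with h' | h' <;> simp [h']
      · simpa [hli] using hx l
    · have hint : ∀ l ∈ Finset.univ.erase i, x l = ((if x l = 1 then 1 else 0 : ℕ) : ℝ) := by
        intro l hl
        have hli : l ≠ i := by simpa using hl
        have hlf : ¬ IsFloating x l := fun hf => hli (hu l i hf hi)
        split_ifs with h1
        · simpa using h1
        · have : ¬ 0 < x l := fun h0 => hlf ⟨h0, lt_of_le_of_ne (hx l).2 h1⟩
          push_cast
          linarith [(hx l).1]
      rw [← Finset.add_sum_erase _ _ (Finset.mem_univ i)] at hN ⊢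
      have e2 : ∑ l ∈ Finset.univ.erase i, Function.update x i s l =
          ∑ l ∈ Finset.univ.erase i, x l := by
        refine Finset.sum_congr rfl fun l hl => ?_
        have hli : l ≠ i := by simpa using hl
        simp [hli]
      rw [e2]
      rw [Finset.sum_congr rfl hint, ← Nat.cast_sum] at hN ⊢
      have hlt : ∑ l ∈ Finset.univ.erase i, (if x l = 1 then 1 else 0 : ℕ) < N := by
        have := hi.1
        exact_mod_cast (by linarith :
          ((∑ l ∈ Finset.univ.erase i, (if x l = 1 then 1 else 0 : ℕ) : ℕ) : ℝ) < N)
      have hle : ((∑ l ∈ Finset.univ.erase i, (if x l = 1 then 1 else 0 : ℕ) : ℕ) : ℝ) + 1 ≤ N := by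
        exact_mod_cast hlt
      have : s ≤ 1 := by rcases hs01 with h' | h' <;> simp [h']
      simp only [Function.update_self]
      linarith
    · refine drop _ i hi ?_ ?_
      · unfold IsFloating
        rcases hs01 with h' | h' <;> simp [h']
      · intro l hl
        by_cases hli : l = i
        · subst hli; exact hi
        · unfold IsFloating at hl ⊢; simpa [hli] using hl
  · rw [h, PMF.support_pure, Set.mem_singleton_iff] at hy
    subst hy
    refine ⟨hx, hN, ?_⟩
    rw [Finset.filter_false_of_mem fun i _ => hn i]
    simp

/-- The law of the vector after `m` steps of dependent rounding. -/
noncomputable def roundingIter (x : ι → ℝ) (m : ℕ) : PMF (ι → ℝ) :=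
  (fun μ : PMF (ι → ℝ) => μ.bind roundingStep)^[m] (PMF.pure x)

theorem roundingIter_succ (x : ι → ℝ) (m : ℕ) :
    roundingIter x (m + 1) = (roundingIter x m).bind roundingStep :=
  Function.iterate_succ_apply' _ _ _

theorem finite_support_roundingIter (x : ι → ℝ) (m : ℕ) : (roundingIter x m).support.Finite := by
  induction m with
  | zero => exact finite_support_pure _
  | succ m ih =>
    rw [roundingIter_succ]
    exact finite_support_bind ih fun y _ => finite_support_roundingStep y

theorem ev_roundingIter_succ (x : ι → ℝ) (m : ℕ) (f : (ι → ℝ) → ℝ) :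
    ev (roundingIter x (m + 1)) f = ev (roundingIter x m) fun y => ev (roundingStep y) f := by
  rw [roundingIter_succ]
  exact ev_bind (finite_support_roundingIter x m) (fun y _ => finite_support_roundingStep y) f

theorem ev_roundingIter_apply (x : ι → ℝ) (m : ℕ) (k : ι) :
    (ev (roundingIter x m) fun y => y k) = x k := by
  induction m with
  | zero => exact ev_pure _ _
  | succ m ih => simp only [ev_roundingIter_succ, ev_roundingStep_apply, ih]

theorem ev_roundingIter_mul_le (x : ι → ℝ) (m : ℕ) {k l : ι} (hkl : k ≠ l) :
    (ev (roundingIter x m) fun y => y k * y l) ≤ x k * x l := by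
  induction m with
  | zero => exact (ev_pure x fun y => y k * y l).le
  | succ m ih =>
    rw [ev_roundingIter_succ]
    exact (ev_mono (finite_support_roundingIter x m)
      fun y _ => ev_roundingStep_mul_le y hkl).trans ih

open Classical in
theorem roundingIter_invariant {x : ι → ℝ} {N : ℕ} (hx : ∀ i, 0 ≤ x i ∧ x i ≤ 1)
    (hN : ∑ i, x i ≤ N) (m : ℕ) : ∀ y ∈ (roundingIter x m).support,
    (∀ i, 0 ≤ y i ∧ y i ≤ 1) ∧ ∑ i, y i ≤ N ∧
      (Finset.univ.filter (IsFloating y)).card ≤ Fintype.card ι - m := by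
  induction m with
  | zero =>
    intro y hy
    have : y = x := by simpa [roundingIter] using hy
    subst this
    exact ⟨hx, hN, Finset.card_le_univ _⟩
  | succ m ih =>
    intro y hy
    rw [roundingIter_succ, PMF.mem_support_bind_iff] at hy
    obtain ⟨z, hz, hy⟩ := hy
    obtain ⟨h1, h2, h3⟩ := ih z hz
    exact roundingStep_invariant h1 h2 (by omega) hy

theorem dependentRounding_eq (x : ι → ℝ) : dependentRounding x =
    (roundingIter x (Fintype.card ι)).map fun y i => @decide (y i = 1) (Classical.propDecidable _) :=
  rfl

theorem roundingIter_integral {x : ι → ℝ} (hx : ∀ i, 0 ≤ x i ∧ x i ≤ 1) {y : ι → ℝ}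
    (hy : y ∈ (roundingIter x (Fintype.card ι)).support) (i : ι) : y i = 0 ∨ y i = 1 := by
  classical
  obtain ⟨N, hN⟩ := exists_nat_ge (∑ i, x i)
  obtain ⟨h1, -, h3⟩ := roundingIter_invariant hx hN _ y hy
  have h4 : ¬ IsFloating y i := by
    have : (Finset.univ.filter (IsFloating y)).card = 0 := by omega
    rw [Finset.card_eq_zero, Finset.filter_eq_empty_iff] at this
    exact this (Finset.mem_univ i)
  by_contra! hne
  exact h4 ⟨lt_of_le_of_ne (h1 i).1 (Ne.symm hne.1), lt_of_le_of_ne (h1 i).2 hne.2⟩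

/-- After `card ι` steps the vector is integral almost surely, so passing to Booleans loses nothing
and moments can be computed on the real-valued iteration. -/
theorem ev_dependentRounding {x : ι → ℝ} (hx : ∀ i, 0 ≤ x i ∧ x i ≤ 1)
    (f : (ι → ℝ) → ℝ) :
    (ev (dependentRounding x) fun X => f fun i => if X i = true then 1 else 0) =
      ev (roundingIter x (Fintype.card ι)) f := by
  classical
  rw [dependentRounding_eq, ev_map (finite_support_roundingIter _ _)]
  refine ev_congr (finite_support_roundingIter _ _) fun y hy => ?_
  congr 1
  ext i
  rcases roundingIter_integral hx hy i with h | h <;> simp [h]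

theorem ev_dependentRounding_apply {x : ι → ℝ} (hx : ∀ i, 0 ≤ x i ∧ x i ≤ 1) (k : ι) :
    (ev (dependentRounding x) fun X => if X k = true then (1 : ℝ) else 0) = x k :=
  (ev_dependentRounding hx fun y => y k).trans (ev_roundingIter_apply x _ k)

theorem ev_dependentRounding_mul_le {x : ι → ℝ} (hx : ∀ i, 0 ≤ x i ∧ x i ≤ 1) {k l : ι}
    (hkl : k ≠ l) :
    (ev (dependentRounding x) fun X =>
      (if X k = true then (1 : ℝ) else 0) * (if X l = true then (1 : ℝ) else 0)) ≤ x k * x l :=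
  (ev_dependentRounding hx fun y => y k * y l).trans_le (ev_roundingIter_mul_le x _ hkl)

/-- Used with `N` the online patience: no arriving vertex exhausts its patience before its last
selected edge. -/
theorem dependentRounding_card_le {x : ι → ℝ} {N : ℕ} (hx : ∀ i, 0 ≤ x i ∧ x i ≤ 1)
    (hN : ∑ i, x i ≤ N) {X : ι → Bool} (hX : X ∈ (dependentRounding x).support) :
    (Finset.univ.filter fun i => X i = true).card ≤ N := by
  classical
  rw [dependentRounding_eq, PMF.support_map] at hX
  obtain ⟨y, hy, rfl⟩ := hX
  have h2 := (roundingIter_invariant hx hN _ y hy).2.1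
  have h3 : ∑ i, y i = ((Finset.univ.filter fun i => y i = 1).card : ℝ) := by
    rw [Finset.card_filter, Nat.cast_sum]
    refine Finset.sum_congr rfl fun i _ => ?_
    rcases roundingIter_integral hx hy i with h | h <;> simp [h]
  rw [h3] at h2
  simpa using h2

end rounding

namespace KIIDInstance

variable {U V 𝒢 : Type*} [Fintype U] [DecidableEq U] [Fintype V] [DecidableEq V] [DecidableEq 𝒢]
variable (I : KIIDInstance U V 𝒢)

/-! ### The probing loop -/

/-- The number of failed probes of the offline vertex `u`. -/
def fails (u : U) (h : I.Hist) : ℕ := h.countP (fun q => q.1 = u ∧ q.2.2 = false)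

/-- The number of failed probes of the online vertex of round `t`. -/
def onlineFails (t : Fin I.T) (h : I.Hist) : ℕ := h.countP (fun q => q.2.1 = t ∧ q.2.2 = false)

/-- The offline vertex `u` is still in the system. -/
def Avail (u : U) (h : I.Hist) : Prop := (∀ t', (u, t', true) ∉ h) ∧ I.fails u h < I.ΔU u

theorem ev_probe {v : V} {u : U} (he : (u, v) ∈ I.E) (t : Fin I.T) (h : I.Hist)
    (F : I.Hist → ℝ) : ev (I.probe v t u h) F =
      I.p (u, v) * F ((u, t, true) :: h) + (1 - I.p (u, v)) * F ((u, t, false) :: h) := by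
  rw [probe, ev_map (Set.toFinite _), ev_coin (I.p_nonneg _ he) (I.p_le_one _ he)]

theorem finite_support_probe (v : V) (t : Fin I.T) (u : U) (h : I.Hist) :
    (I.probe v t u h).support.Finite :=
  finite_support_map (Set.toFinite _) _

theorem mem_support_probe {v : V} {t : Fin I.T} {u : U} {h h' : I.Hist}
    (hh : h' ∈ (I.probe v t u h).support) : ∃ s, h' = (u, t, s) :: h := by
  rw [probe, PMF.support_map] at hh
  obtain ⟨s, -, rfl⟩ := hh
  exact ⟨s, rfl⟩

section loop

variable {v : V} {t : Fin I.T} {X : I.Nbr v → Bool}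

theorem probeLoop_cons_pos {u : I.Nbr v} {h : I.Hist} (l : List (I.Nbr v))
    (hu : X u = true ∧ I.CanProbe v t u.1 h) :
    I.probeLoop v t X (u :: l) h = (I.probe v t u.1 h).bind (I.probeLoop v t X l) := by
  rw [probeLoop, if_pos hu]

theorem probeLoop_cons_neg {u : I.Nbr v} {h : I.Hist} (l : List (I.Nbr v))
    (hu : ¬ (X u = true ∧ I.CanProbe v t u.1 h)) :
    I.probeLoop v t X (u :: l) h = I.probeLoop v t X l h := by
  rw [probeLoop, if_neg hu]

theorem finite_support_probeLoop (l : List (I.Nbr v)) (h : I.Hist) :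
    (I.probeLoop v t X l h).support.Finite := by
  induction l generalizing h with
  | nil => exact finite_support_pure _
  | cons u l ih =>
    by_cases hu : X u = true ∧ I.CanProbe v t u.1 h
    · rw [probeLoop_cons_pos I l hu]
      exact finite_support_bind (I.finite_support_probe _ _ _ _) fun h' _ => ih h'
    · rw [probeLoop_cons_neg I l hu]
      exact ih h

theorem ev_probeLoop_cons {u : I.Nbr v} {h : I.Hist} (l : List (I.Nbr v))
    (hu : X u = true ∧ I.CanProbe v t u.1 h) (F : I.Hist → ℝ) :
    ev (I.probeLoop v t X (u :: l) h) F =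
      I.p (u.1, v) * ev (I.probeLoop v t X l ((u.1, t, true) :: h)) F +
      (1 - I.p (u.1, v)) * ev (I.probeLoop v t X l ((u.1, t, false) :: h)) F := by
  rw [probeLoop_cons_pos I l hu, ev_bind (I.finite_support_probe _ _ _ _)
    (fun h' _ => I.finite_support_probeLoop l h'), ev_probe I u.2]

/-- A property of histories that survives every probe of the round survives the loop. -/
theorem probeLoop_induction {P : I.Hist → Prop} (hP : ∀ (u : I.Nbr v) (s : Bool) (h : I.Hist),
    P h → P ((u.1, t, s) :: h)) (l : List (I.Nbr v)) {h h' : I.Hist} (h0 : P h)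
    (hh : h' ∈ (I.probeLoop v t X l h).support) : P h' := by
  induction l generalizing h with
  | nil =>
    have : h' = h := by simpa [probeLoop] using hh
    rwa [this]
  | cons u l ih =>
    by_cases hu : X u = true ∧ I.CanProbe v t u.1 h
    · rw [probeLoop_cons_pos I l hu, PMF.mem_support_bind_iff] at hh
      obtain ⟨h1, hh1, hh⟩ := hh
      obtain ⟨s, rfl⟩ := I.mem_support_probe hh1
      exact ih (hP _ _ _ h0) hh
    · rw [probeLoop_cons_neg I l hu] at hh
      exact ih h0 hh

/-- A nonnegative function of the state of one offline vertex `u`, which loses at most `c` through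
a failed probe, loses in one pass at most what one probe of `u` may cost. -/
theorem le_ev_probeLoop_of_local (u : I.Nbr v) {F : I.Hist → ℝ} {c : ℝ} (hF0 : ∀ h, 0 ≤ F h)
    (hc : 0 ≤ c) (hne : ∀ (u' : U) (s : Bool) (h : I.Hist), u' ≠ u.1 → F ((u', t, s) :: h) = F h)
    (hfail : ∀ h, F h - c ≤ F ((u.1, t, false) :: h)) (l : List (I.Nbr v)) (hl : l.Nodup)
    (h : I.Hist) : F h - (if u ∈ l ∧ X u = true then I.p (u.1, v) * F h + c else 0) ≤
      ev (I.probeLoop v t X l h) F := by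
  have hp0 := I.p_nonneg _ u.2
  have hp1 := I.p_le_one _ u.2
  induction l generalizing h with
  | nil => simp [probeLoop]
  | cons g l ih =>
    obtain ⟨hg, hl⟩ := List.nodup_cons.1 hl
    have ih := ih hl
    by_cases hgu : g = u
    · subst hgu
      simp only [hg, false_and, if_false, sub_zero] at ih
      have hL : 0 ≤ I.p (g.1, v) * F h + c := add_nonneg (mul_nonneg hp0 (hF0 h)) hc
      by_cases hu : X g = true ∧ I.CanProbe v t g.1 h
      · rw [ev_probeLoop_cons I l hu]
        simp only [List.mem_cons, true_or, hu.1, and_self, if_true]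
        -- A success may cost the whole value `F h`, a failure at most `c`; the tail costs nothing
        -- because `g` does not recur in it.
        have h1 := mul_nonneg hp0 ((hF0 _).trans (ih ((g.1, t, true) :: h)))
        have h2 := mul_le_mul_of_nonneg_left ((hfail h).trans (ih ((g.1, t, false) :: h)))
          (sub_nonneg.2 hp1)
        have h3 := mul_nonneg hp0 hc
        linarith
      · rw [probeLoop_cons_neg I l hu]
        refine le_trans ?_ (ih h)
        split_ifs <;> linarith
    · have hmem : (u ∈ g :: l ∧ X u = true) ↔ (u ∈ l ∧ X u = true) := by
        simp [Ne.symm hgu]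
      simp only [hmem]
      have hgu' : g.1 ≠ u.1 := fun h => hgu (Subtype.ext h)
      by_cases hu : X g = true ∧ I.CanProbe v t g.1 h
      · rw [ev_probeLoop_cons I l hu]
        have h1 := ih ((g.1, t, true) :: h)
        have h2 := ih ((g.1, t, false) :: h)
        rw [hne _ _ _ hgu'] at h1 h2
        have h1 := mul_le_mul_of_nonneg_left h1 (I.p_nonneg _ g.2)
        have h2 := mul_le_mul_of_nonneg_left h2 (sub_nonneg.2 (I.p_le_one _ g.2))
        linarith
      · rw [probeLoop_cons_neg I l hu]
        exact ih h

/-- An available selected vertex is matched unless it fails, or one of the selected vertices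
before it succeeds. -/
theorem le_ev_probeLoop_matched (u : I.Nbr v) (l : List (I.Nbr v)) (hl : l.Nodup) (hul : u ∈ l)
    (h : I.Hist) (hav : I.Avail u.1 h) (hfresh : ∀ f ∈ l, ∀ s, (f.1, t, s) ∉ h)
    (hun : ∀ u', (u', t, true) ∉ h)
    (hpat : I.onlineFails t h + l.countP X ≤ I.ΔV v) (hX : X u = true) :
    I.p (u.1, v) * (1 - ∑ f : I.Nbr v, if l.idxOf f < l.idxOf u then
        (if X f = true then I.p (f.1, v) else 0) else 0) ≤
      ev (I.probeLoop v t X l h) fun h' => if (u.1, t, true) ∈ h' then 1 else 0 := by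
  induction l generalizing h with
  | nil => simp at hul
  | cons g l ih =>
    obtain ⟨hg, hl⟩ := List.nodup_cons.1 hl
    by_cases hgu : g = u
    · subst hgu
      -- Failures so far plus the selected vertices still to come do not exceed the patience, and
      -- `g` itself is among the latter; this gives the strict inequality.
      have hcan : I.CanProbe v t g.1 h := by
        refine ⟨g.2, hfresh g (by simp), hav.1, hav.2, hun, ?_⟩
        rw [List.countP_cons_of_pos hX, onlineFails] at hpat
        omega
      rw [ev_probeLoop_cons I l ⟨hX, hcan⟩]
      have h1 : (ev (I.probeLoop v t X l ((g.1, t, true) :: h))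
          fun h' => if (g.1, t, true) ∈ h' then (1 : ℝ) else 0) = 1 := by
        refine Eq.trans ?_ (ev_const (I.probeLoop v t X l ((g.1, t, true) :: h)) 1)
        refine ev_congr (I.finite_support_probeLoop _ _) fun h' hh => ?_
        rw [if_pos]
        exact I.probeLoop_induction (P := fun h => (g.1, t, true) ∈ h)
          (fun u s h hm => List.mem_cons_of_mem _ hm) l (by simp) hh
      have h2 : 0 ≤ (ev (I.probeLoop v t X l ((g.1, t, false) :: h))
          fun h' => if (g.1, t, true) ∈ h' then (1 : ℝ) else 0) :=
        ev_nonneg (I.finite_support_probeLoop _ _) fun h' _ => by split_ifs <;> simp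
      have h3 := mul_nonneg (sub_nonneg.2 (I.p_le_one _ g.2)) h2
      rw [h1]
      simp
      linarith
    · have hgu' : g.1 ≠ u.1 := fun h => hgu (Subtype.ext h)
      have hul' : u ∈ l := by simpa [Ne.symm hgu] using hul
      have hsum : (∑ f : I.Nbr v, if (g :: l).idxOf f < (g :: l).idxOf u then
          (if X f = true then I.p (f.1, v) else 0) else 0) =
          (if X g = true then I.p (g.1, v) else 0) +
          ∑ f : I.Nbr v, if l.idxOf f < l.idxOf u then
          (if X f = true then I.p (f.1, v) else 0) else 0 := by
        have hd : (if X g = true then I.p (g.1, v) else 0) =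
            ∑ f : I.Nbr v, if f = g then (if X f = true then I.p (f.1, v) else 0) else 0 := by
          simp
        rw [hd, ← Finset.sum_add_distrib]
        refine Finset.sum_congr rfl fun f _ => ?_
        by_cases hfg : f = g
        · subst hfg
          have : ¬ l.idxOf f < l.idxOf u := by
            rw [List.idxOf_of_notMem hg]
            have := List.idxOf_lt_length_of_mem hul'
            omega
          simp [this, List.idxOf_cons_ne _ hgu]
        · rw [List.idxOf_cons_ne _ (Ne.symm hfg), List.idxOf_cons_ne _ hgu]
          simp [hfg]
      rw [hsum]
      set S := ∑ f : I.Nbr v, if l.idxOf f < l.idxOf u then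
          (if X f = true then I.p (f.1, v) else 0) else 0 with hS
      have hS0 : 0 ≤ S := Finset.sum_nonneg fun f _ => by
        split_ifs <;> first | exact I.p_nonneg _ f.2 | exact le_rfl
      have hpu := I.p_nonneg _ u.2
      have hpg := I.p_nonneg _ g.2
      by_cases hu : X g = true ∧ I.CanProbe v t g.1 h
      · rw [ev_probeLoop_cons I l hu]
        rw [List.countP_cons_of_pos hu.1] at hpat
        have h1 : 0 ≤ (ev (I.probeLoop v t X l ((g.1, t, true) :: h))
            fun h' => if (u.1, t, true) ∈ h' then (1 : ℝ) else 0) :=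
          ev_nonneg (I.finite_support_probeLoop _ _) fun h' _ => by split_ifs <;> simp
        have h2 := ih hl hul' ((g.1, t, false) :: h)
          ⟨by simpa [Ne.symm hgu'] using hav.1, by
            have := hav.2
            unfold fails at this ⊢
            rwa [List.countP_cons_of_neg (by simp [hgu'])]⟩
          (by
            intro f hf s
            have hfg : f ≠ g := fun h => hg (h ▸ hf)
            have hfg' : f.1 ≠ g.1 := fun h => hfg (Subtype.ext h)
            simpa [hfg'] using hfresh f (by simp [hf]) s)
          (by simpa using hun)
          (by
            unfold onlineFails at hpat ⊢
            rw [List.countP_cons_of_pos (by simp)]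
            omega)
        have h2 := mul_le_mul_of_nonneg_left h2 (sub_nonneg.2 (I.p_le_one _ g.2))
        have h1 := mul_nonneg hpg h1
        rw [if_pos hu.1]
        -- Union bound: `(1 - p_g)(1 - S) ≥ 1 - p_g - S`. The outcome in which `g` succeeds is
        -- simply discarded.
        have h3 := mul_nonneg (mul_nonneg hpg hpu) hS0
        linarith
      · rw [probeLoop_cons_neg I l hu]
        refine le_trans ?_ (ih hl hul' h hav (fun f hf => hfresh f (by simp [hf])) hun
          (by rw [List.countP_cons] at hpat; omega))
        refine mul_le_mul_of_nonneg_left ?_ hpu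
        have : 0 ≤ (if X g = true then I.p (g.1, v) else 0) := by
          split_ifs <;> first | exact hpg | exact le_rfl
        linarith

end loop

end KIIDInstance
/-! ### Uniformly random orders -/

theorem idxOf_map_equiv {α : Type*} [BEq α] [LawfulBEq α] (σ : Equiv.Perm α) (L : List α) (y : α) :
    (L.map σ).idxOf y = L.idxOf (σ.symm y) := by
  induction L with
  | nil => rfl
  | cons x L ih =>
    by_cases h : σ x = y
    · subst h; simp
    · have h' : x ≠ σ.symm y := fun h' => h (by simp [h'])
      rw [List.map_cons, List.idxOf_cons_ne _ h, List.idxOf_cons_ne _ h', ih]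

/-- In a uniformly random order, a given element precedes another one with probability at most
one half. -/
theorem two_mul_sum_perm_before_le {α : Type*} [Fintype α] [DecidableEq α] [BEq α]
    [LawfulBEq α] (L : List α)
    (f u : α) : 2 * ∑ π : Equiv.Perm α,
      (if (L.map π).idxOf f < (L.map π).idxOf u then (1 : ℝ) else 0) ≤
      Fintype.card (Equiv.Perm α) := by
  have hswap : ∑ π : Equiv.Perm α,
      (if (L.map π).idxOf f < (L.map π).idxOf u then (1 : ℝ) else 0) =
      ∑ π : Equiv.Perm α,
      (if (L.map π).idxOf u < (L.map π).idxOf f then (1 : ℝ) else 0) := by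
    -- Composing an order with the transposition of `f` and `u` exchanges their positions; the two
    -- opposite strict comparisons are exclusive.
    rw [← Equiv.sum_comp (Equiv.mulLeft (Equiv.swap f u))]
    refine Finset.sum_congr rfl fun π _ => ?_
    have : L.map (Equiv.mulLeft (Equiv.swap f u) π) = (L.map π).map (Equiv.swap f u) := by
      simp [List.map_map]
    rw [this, idxOf_map_equiv (Equiv.swap f u) _ f, idxOf_map_equiv (Equiv.swap f u) _ u,
      Equiv.symm_swap, Equiv.swap_apply_left, Equiv.swap_apply_right]
  rw [two_mul]
  nth_rewrite 2 [hswap]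
  rw [← Finset.sum_add_distrib, ← Finset.card_univ, Finset.card_eq_sum_ones, Nat.cast_sum]
  refine Finset.sum_le_sum fun π _ => ?_
  split_ifs <;> first | omega | norm_num

namespace KIIDInstance

variable {U V 𝒢 : Type*} [Fintype U] [DecidableEq U] [Fintype V] [DecidableEq V] [DecidableEq 𝒢]
variable (I : KIIDInstance U V 𝒢)

/-! ### One run of `PPDR` -/

section ppdr

variable {v : V} {t : Fin I.T} {x : I.Nbr v → ℝ}

theorem finite_support_ppdr (h : I.Hist) : (I.ppdr v t x h).support.Finite :=
  finite_support_bind (Set.toFinite _) fun _ _ =>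
    finite_support_bind (Set.toFinite _) fun _ _ => I.finite_support_probeLoop _ _

theorem ev_ppdr (h : I.Hist) (F : I.Hist → ℝ) : ev (I.ppdr v t x h) F =
    ev (dependentRounding x) fun X => ev (PMF.uniformOfFintype (Equiv.Perm (I.Nbr v))) fun π =>
      ev (I.probeLoop v t X (Finset.univ.toList.map π) h) F := by
  rw [ppdr, ev_bind (Set.toFinite _) fun _ _ =>
    finite_support_bind (Set.toFinite _) fun _ _ => I.finite_support_probeLoop _ _]
  refine ev_congr (Set.toFinite _) fun X _ => ?_
  rw [ev_bind (Set.toFinite _) fun _ _ => I.finite_support_probeLoop _ _]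

theorem nodup_order (π : Equiv.Perm (I.Nbr v)) :
    ((Finset.univ : Finset (I.Nbr v)).toList.map π).Nodup :=
  (Finset.nodup_toList _).map π.injective

theorem mem_order (π : Equiv.Perm (I.Nbr v)) (u : I.Nbr v) :
    u ∈ (Finset.univ : Finset (I.Nbr v)).toList.map π := by
  rw [List.mem_map]
  exact ⟨π.symm u, by simp, by simp⟩

theorem countP_order (π : Equiv.Perm (I.Nbr v)) (X : I.Nbr v → Bool) :
    ((Finset.univ : Finset (I.Nbr v)).toList.map π).countP X =
      (Finset.univ.filter fun u => X u = true).card := by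
  rw [List.countP_eq_length_filter, ← List.toFinset_card_of_nodup ((I.nodup_order π).filter _)]
  congr 1
  ext u
  simp only [List.mem_toFinset, List.mem_filter, I.mem_order π u, true_and, Finset.mem_filter,
    Finset.mem_univ]

theorem ppdr_induction {P : I.Hist → Prop} (hP : ∀ (u : I.Nbr v) (s : Bool) (h : I.Hist),
    P h → P ((u.1, t, s) :: h)) {h h' : I.Hist} (h0 : P h)
    (hh : h' ∈ (I.ppdr v t x h).support) : P h' := by
  simp only [ppdr, PMF.mem_support_bind_iff] at hh
  obtain ⟨X, -, π, -, hh⟩ := hh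
  exact I.probeLoop_induction hP _ h0 hh

/-- The loss in the loop depends on the rounding only through whether `u` is selected, so the
marginals suffice here and no correlation bound is needed. -/
theorem le_ev_ppdr_of_local (hx : ∀ i, 0 ≤ x i ∧ x i ≤ 1) (u : I.Nbr v) {F : I.Hist → ℝ} {c : ℝ}
    (hF0 : ∀ h, 0 ≤ F h) (hc : 0 ≤ c)
    (hne : ∀ (u' : U) (s : Bool) (h : I.Hist), u' ≠ u.1 → F ((u', t, s) :: h) = F h)
    (hfail : ∀ h, F h - c ≤ F ((u.1, t, false) :: h)) (h : I.Hist) :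
    F h - x u * (I.p (u.1, v) * F h + c) ≤ ev (I.ppdr v t x h) F := by
  rw [ev_ppdr]
  calc F h - x u * (I.p (u.1, v) * F h + c)
      = ev (dependentRounding x) fun X =>
          F h - (if X u = true then (1 : ℝ) else 0) * (I.p (u.1, v) * F h + c) := by
        rw [ev_sub (Set.toFinite _), ev_const, ev_mul_const, ev_dependentRounding_apply hx]
    _ ≤ _ := by
        refine ev_mono (Set.toFinite _) fun X _ => ?_
        refine le_trans (le_of_eq ?_) (ev_mono (Set.toFinite _) fun π _ =>
          I.le_ev_probeLoop_of_local u hF0 hc hne hfail _ (I.nodup_order π) h)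
        simp only [I.mem_order, true_and, ev_const]
        split_ifs <;> ring

/-- A competitor `f` is selected together with `u` with probability at most `x u * x f`, precedes it
with probability at most one half, and succeeds with probability `p f`. By the online capacity
constraint these losses total at most half of `x u`. -/
theorem le_ev_ppdr_matched (hx : ∀ i, 0 ≤ x i ∧ x i ≤ 1) (hsum : ∑ i, x i ≤ I.ΔV v)
    (hcap : ∑ i, x i * I.p (i.1, v) ≤ 1) (u : I.Nbr v) (h : I.Hist) (hav : I.Avail u.1 h)
    (hfresh : ∀ u' s, (u', t, s) ∉ h) :
    x u * I.p (u.1, v) / 2 ≤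
      ev (I.ppdr v t x h) fun h' => if (u.1, t, true) ∈ h' then 1 else 0 := by
  have hpu := I.p_nonneg _ u.2
  have h0 : I.onlineFails t h = 0 := by
    rw [onlineFails, List.countP_eq_zero]
    rintro ⟨u', t', s⟩ hq
    simp only [decide_eq_true_eq]
    rintro ⟨rfl, -⟩
    exact hfresh _ _ hq
  set b : (I.Nbr v → Bool) → I.Nbr v → ℝ := fun X i => if X i = true then 1 else 0 with hb
  rw [ev_ppdr]
  calc x u * I.p (u.1, v) / 2
      ≤ I.p (u.1, v) * (x u - ∑ f ∈ Finset.univ.erase u, x u * x f * (I.p (f.1, v) / 2)) := by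
        have : ∑ f ∈ Finset.univ.erase u, x u * x f * (I.p (f.1, v) / 2) ≤ x u / 2 := by
          calc ∑ f ∈ Finset.univ.erase u, x u * x f * (I.p (f.1, v) / 2)
              = x u / 2 * ∑ f ∈ Finset.univ.erase u, x f * I.p (f.1, v) := by
                rw [Finset.mul_sum]
                exact Finset.sum_congr rfl fun f _ => by ring
            _ ≤ x u / 2 * 1 := by
                refine mul_le_mul_of_nonneg_left (le_trans ?_ hcap) (by linarith [(hx u).1])
                exact Finset.sum_le_sum_of_subset_of_nonneg (Finset.erase_subset _ _)
                  fun f _ _ => mul_nonneg (hx f).1 (I.p_nonneg _ f.2)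
            _ = x u / 2 := mul_one _
        calc x u * I.p (u.1, v) / 2 = I.p (u.1, v) * (x u - x u / 2) := by ring
          _ ≤ _ := mul_le_mul_of_nonneg_left (by linarith) hpu
    _ ≤ I.p (u.1, v) * ((ev (dependentRounding x) fun X => b X u) -
          ∑ f ∈ Finset.univ.erase u,
            (ev (dependentRounding x) fun X => b X u * b X f) * (I.p (f.1, v) / 2)) := by
        rw [ev_dependentRounding_apply hx]
        refine mul_le_mul_of_nonneg_left (sub_le_sub_left (Finset.sum_le_sum fun f hf => ?_) _) hpu
        exact mul_le_mul_of_nonneg_right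
          (ev_dependentRounding_mul_le hx (Finset.ne_of_mem_erase hf).symm)
          (by linarith [I.p_nonneg _ f.2])
    _ = ev (dependentRounding x) fun X => I.p (u.1, v) * (b X u -
          ∑ f ∈ Finset.univ.erase u, b X u * b X f * (I.p (f.1, v) / 2)) := by
        rw [ev_const_mul, ev_sub (Set.toFinite _), ev_sum (Set.toFinite _)]
        simp only [ev_mul_const]
    _ ≤ _ := by
        refine ev_mono (Set.toFinite _) fun X hX => ?_
        by_cases hXu : X u = true
        swap
        · simp only [hb, hXu]
          simp only [Bool.false_eq_true, if_false, zero_mul, Finset.sum_const_zero, sub_zero,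
            mul_zero]
          exact ev_nonneg (Set.toFinite _) fun π _ =>
            ev_nonneg (I.finite_support_probeLoop _ _) fun h' _ => by split_ifs <;> simp
        -- For a fixed selection containing `u`, only the random order remains to be averaged.
        refine le_trans ?_ (ev_mono (Set.toFinite _) fun π _ =>
          I.le_ev_probeLoop_matched u _ (I.nodup_order π) (I.mem_order π u) h hav
            (fun f _ s => hfresh _ _) (fun u' => hfresh _ _)
            (by rw [h0, I.countP_order, zero_add]; exact dependentRounding_card_le hx hsum hX) hXu)
        rw [ev_const_mul, ev_sub (Set.toFinite _), ev_const, ev_sum (Set.toFinite _)]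
        refine mul_le_mul_of_nonneg_left ?_ hpu
        have hbu : b X u = 1 := by simp [hb, hXu]
        rw [hbu, ← Finset.add_sum_erase _ _ (Finset.mem_univ u)]
        simp only [lt_irrefl, if_false, ev_const, zero_add, one_mul]
        refine sub_le_sub_left (Finset.sum_le_sum fun f _ => ?_) _
        have hpf : (if X f = true then I.p (f.1, v) else 0) = b X f * I.p (f.1, v) := by
          simp [hb]
        have hind : ∀ π : Equiv.Perm (I.Nbr v),
            (if (Finset.univ.toList.map π).idxOf f < (Finset.univ.toList.map π).idxOf u then
              (if X f = true then I.p (f.1, v) else 0) else 0) =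
            (if (Finset.univ.toList.map π).idxOf f < (Finset.univ.toList.map π).idxOf u then
              (1 : ℝ) else 0) * (b X f * I.p (f.1, v)) := by
          intro π; rw [hpf]; split_ifs <;> simp
        simp only [hind]
        rw [ev_mul_const, ev_uniformOfFintype]
        have hbf : 0 ≤ b X f * I.p (f.1, v) :=
          mul_nonneg (by simp only [hb]; split_ifs <;> simp) (I.p_nonneg _ f.2)
        have hcard : (0 : ℝ) < Fintype.card (Equiv.Perm (I.Nbr v)) := by
          exact_mod_cast Fintype.card_pos
        have h2 := two_mul_sum_perm_before_le (Finset.univ : Finset (I.Nbr v)).toList f u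
        have h3 : (Fintype.card (Equiv.Perm (I.Nbr v)) : ℝ)⁻¹ * ∑ π : Equiv.Perm (I.Nbr v),
            (if (Finset.univ.toList.map π).idxOf f < (Finset.univ.toList.map π).idxOf u then
              (1 : ℝ) else 0) ≤ 1 / 2 := by
          rw [inv_mul_le_iff₀ hcard]
          linarith
        calc _ ≤ 1 / 2 * (b X f * I.p (f.1, v)) := mul_le_mul_of_nonneg_right h3 hbf
          _ = _ := by ring

end ppdr

/-! ### Sums over the edges of the split graph -/

theorem sum_copyEdges_offline (G : U × I.Copy → ℝ) (u : U) :
    ∑ e ∈ I.copyEdges with e.1 = u, G e =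
      ∑ v, if (u, v) ∈ I.E then ∑ k, G (u, ⟨v, k⟩) else 0 := by
  rw [copyEdges, Finset.filter_filter, Finset.sum_filter, Fintype.sum_prod_type,
    Finset.sum_eq_single u]
  · rw [Fintype.sum_sigma]
    refine Finset.sum_congr rfl fun v _ => ?_
    by_cases h : (u, v) ∈ I.E <;> simp [h]
  · intro u' _ hu
    simp [hu]
  · simp

theorem sum_copyEdges_online (G : U × I.Copy → ℝ) (c : I.Copy) :
    ∑ e ∈ I.copyEdges with e.2 = c, G e = ∑ u : I.Nbr c.1, G (u.1, c) := by
  rw [copyEdges, Finset.filter_filter, Finset.sum_filter, Fintype.sum_prod_type_right,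
    Finset.sum_eq_single c]
  · rw [← Finset.sum_filter (p := fun u => (u, c.1) ∈ I.E ∧ c = c)]
    simp only [and_true]
    exact Finset.sum_subtype _ (by simp) _
  · intro c' _ hc
    simp [hc]
  · simp

theorem sum_copyEdges (G : U × I.Copy → ℝ) :
    ∑ e ∈ I.copyEdges, G e = ∑ u, ∑ e ∈ I.copyEdges with e.1 = u, G e :=
  (Finset.sum_fiberwise _ _ _).symm

theorem T_pos [Nonempty V] : 0 < I.T := by
  obtain ⟨v⟩ := ‹Nonempty V›
  rcases Nat.eq_zero_or_pos I.T with h | h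
  · have h1 := I.n_eq v
    have h2 := I.n_pos v
    rw [h, Nat.cast_zero, zero_mul] at h1
    have : I.n v = 0 := by exact_mod_cast h1.symm
    omega
  · exact h

theorem arr_eq (v : V) (hT : 0 < I.T) : (I.arr v).toReal = I.n v / I.T := by
  have : (I.T : ℝ) ≠ 0 := by positivity
  rw [← I.n_eq v]
  field_simp

theorem n_ne_zero (v : V) : (I.n v : ℝ) ≠ 0 := by
  have := I.n_pos v
  positivity

/-! ### One round -/

section round

variable {q : PMF (Option (Fin 3))} {s : Fin 3 → U × I.Copy → ℝ}

theorem tsgfRound_eq (v : V) (t : Fin I.T) (h : I.Hist) :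
    haveI : Nonempty (Fin (I.n v)) := ⟨⟨0, I.n_pos v⟩⟩
    I.tsgfRound q s v t h = (PMF.uniformOfFintype (Fin (I.n v))).bind fun k => q.bind fun o =>
      o.elim (PMF.pure h) fun i => I.ppdr v t (fun u => s i (u.1, ⟨v, k⟩)) h := by
  unfold tsgfRound
  congr 1
  funext k
  congr 1
  funext o
  cases o <;> rfl

theorem finite_support_choice_ppdr {v : V} {t : Fin I.T} {h : I.Hist} (k : Fin (I.n v))
    (o : Option (Fin 3)) : (o.elim (PMF.pure h) fun i =>
      I.ppdr v t (fun u => s i (u.1, ⟨v, k⟩)) h : PMF I.Hist).support.Finite := by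
  cases o with
  | none => exact finite_support_pure _
  | some i => exact I.finite_support_ppdr _

theorem finite_support_tsgfRound (v : V) (t : Fin I.T) (h : I.Hist) :
    (I.tsgfRound q s v t h).support.Finite := by
  rw [tsgfRound_eq]
  exact finite_support_bind (Set.toFinite _) fun k _ =>
    finite_support_bind (Set.toFinite _) fun o _ => I.finite_support_choice_ppdr k o

theorem ev_tsgfRound (v : V) (t : Fin I.T) (h : I.Hist) (F : I.Hist → ℝ) :
    ev (I.tsgfRound q s v t h) F = (I.n v : ℝ)⁻¹ * ∑ k, ((q none).toReal * F h +
      ∑ i, (q (some i)).toReal * ev (I.ppdr v t (fun u => s i (u.1, ⟨v, k⟩)) h) F) := by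
  have : Nonempty (Fin (I.n v)) := ⟨⟨0, I.n_pos v⟩⟩
  rw [tsgfRound_eq, ev_bind (Set.toFinite _) fun k _ => finite_support_bind (Set.toFinite _)
    fun o _ => I.finite_support_choice_ppdr k o, ev_uniformOfFintype, Fintype.card_fin]
  congr 1
  refine Finset.sum_congr rfl fun k _ => ?_
  rw [ev_bind (Set.toFinite _) fun o _ => I.finite_support_choice_ppdr k o, ev_fintype,
    Fintype.sum_option]
  simp only [Option.elim, ev_pure]

theorem tsgfRound_induction {v : V} {t : Fin I.T} {P : I.Hist → Prop}
    (hP : ∀ (u : I.Nbr v) (s : Bool) (h : I.Hist), P h → P ((u.1, t, s) :: h)) {h h' : I.Hist}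
    (h0 : P h) (hh : h' ∈ (I.tsgfRound q s v t h).support) : P h' := by
  simp only [tsgfRound, PMF.mem_support_bind_iff] at hh
  obtain ⟨k, -, o, -, hh⟩ := hh
  cases o with
  | none =>
    have : h' = h := by simpa using hh
    rwa [this]
  | some i => exact I.ppdr_induction hP h0 hh

/-- The contribution of the offline vertex `u` to the value of a linear program with weights `w`. -/
noncomputable def load (w : U × V → ℝ) (x : U × I.Copy → ℝ) (u : U) : ℝ :=
  ∑ v, if (u, v) ∈ I.E then ∑ k, w (u, v) * x (u, ⟨v, k⟩) * I.p (u, v) else 0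

theorem LPFeasible.mem_unit {I : KIIDInstance U V 𝒢} {x : U × I.Copy → ℝ} (hx : I.LPFeasible x)
    {v : V} (u : I.Nbr v) (k : Fin (I.n v)) : 0 ≤ x (u.1, ⟨v, k⟩) ∧ x (u.1, ⟨v, k⟩) ≤ 1 := by
  have : ((u.1, ⟨v, k⟩) : U × I.Copy) ∈ I.copyEdges := by simp [copyEdges, u.2]
  exact ⟨hx.nonneg _ this, hx.le_one _ this⟩

theorem sum_q (q : PMF (Option (Fin 3))) :
    (q none).toReal + ∑ i, (q (some i)).toReal = 1 := by
  have := ev_const q 1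
  rw [ev_fintype, Fintype.sum_option] at this
  simpa using this

/-- Only the branch that uses solution `i` is counted; rejection and the other solutions contribute
nonnegatively. -/
theorem le_ev_tsgfRound_matched (hs : ∀ i, I.LPFeasible (s i)) (i : Fin 3) {v : V}
    (u : I.Nbr v) (t : Fin I.T) (h : I.Hist) (hav : I.Avail u.1 h) (hfresh : ∀ u' b, (u', t, b) ∉ h) :
    (I.n v : ℝ)⁻¹ * ((q (some i)).toReal / 2 * ∑ k, s i (u.1, ⟨v, k⟩) * I.p (u.1, v)) ≤
      ev (I.tsgfRound q s v t h) fun h' => if (u.1, t, true) ∈ h' then 1 else 0 := by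
  rw [ev_tsgfRound, Finset.mul_sum]
  refine mul_le_mul_of_nonneg_left (Finset.sum_le_sum fun k _ => ?_) (by positivity)
  have h1 := I.le_ev_ppdr_matched (t := t) (x := fun u => s i (u.1, ⟨v, k⟩))
    (fun u => (hs i).mem_unit u k)
    (by simpa only [sum_copyEdges_online] using (hs i).online_patience ⟨v, k⟩)
    (by simpa only [sum_copyEdges_online] using (hs i).online_capacity ⟨v, k⟩) u h hav hfresh
  have h2 := mul_le_mul_of_nonneg_left h1 (ENNReal.toReal_nonneg (a := q (some i)))
  have h3 : ∀ j, 0 ≤ (q (some j)).toReal * ev (I.ppdr v t (fun u => s j (u.1, ⟨v, k⟩)) h)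
      fun h' => if (u.1, t, true) ∈ h' then (1 : ℝ) else 0 := fun j =>
    mul_nonneg ENNReal.toReal_nonneg (ev_nonneg (I.finite_support_ppdr _) fun h' _ => by
      split_ifs <;> simp)
  have h4 := Finset.single_le_sum (fun j _ => h3 j) (Finset.mem_univ i)
  have h5 : 0 ≤ (q none).toReal * (if (u.1, t, true) ∈ h then (1 : ℝ) else 0) :=
    mul_nonneg ENNReal.toReal_nonneg (by split_ifs <;> simp)
  refine le_trans (le_of_eq ?_) (le_trans (h2.trans h4) (le_add_of_nonneg_left h5))
  ring

/-- An available offline vertex gains in one round half of its share of each linear program. -/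
theorem le_ev_round_matched (hs : ∀ i, I.LPFeasible (s i)) (hT : 0 < I.T) (i : Fin 3)
    {w : U × V → ℝ} (hw : ∀ e, 0 ≤ w e) (u : U)
    (t : Fin I.T) (h : I.Hist) (hav : I.Avail u h) (hfresh : ∀ u' b, (u', t, b) ∉ h) :
    (q (some i)).toReal / (2 * I.T) * I.load w (s i) u ≤
      ev I.arr fun v => ev (I.tsgfRound q s v t h) fun h' =>
        if (u, t, true) ∈ h' then w (u, v) else 0 := by
  rw [ev_fintype, load, Finset.mul_sum]
  refine Finset.sum_le_sum fun v _ => ?_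
  have hw' : (ev (I.tsgfRound q s v t h) fun h' => if (u, t, true) ∈ h' then w (u, v) else 0) =
      w (u, v) * ev (I.tsgfRound q s v t h) fun h' => if (u, t, true) ∈ h' then 1 else 0 := by
    rw [← ev_const_mul]
    simp
  rw [hw']
  split_ifs with he
  · have h1 := I.le_ev_tsgfRound_matched (q := q) hs i ⟨u, he⟩ t h hav hfresh
    have h2 := mul_le_mul_of_nonneg_left h1 (hw (u, v))
    have h3 := mul_le_mul_of_nonneg_left h2 (ENNReal.toReal_nonneg (a := I.arr v))
    refine le_trans (le_of_eq ?_) h3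
    -- The arrival probability `n v / T` cancels the average over the `n v` copies, leaving `1 / T`.
    rw [I.arr_eq v hT]
    have := I.n_ne_zero v
    have : (I.T : ℝ) ≠ 0 := by positivity
    simp only [mul_assoc, ← Finset.mul_sum]
    field_simp
    exact congrArg _ (Finset.sum_congr rfl fun k _ => mul_comm _ _)
  · rw [mul_zero]
    exact mul_nonneg ENNReal.toReal_nonneg (mul_nonneg (hw _)
      (ev_nonneg (I.finite_support_tsgfRound _ _ _) fun h' _ => by split_ifs <;> simp))

/-- For losses, in contrast to gains, all three solutions are charged; only rejection is free. -/
theorem le_ev_tsgfRound_of_local (hs : ∀ i, I.LPFeasible (s i))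
    (u : U) (v : V) (t : Fin I.T) {F : I.Hist → ℝ} {c : ℝ}
    (hF0 : ∀ h, 0 ≤ F h) (hc : 0 ≤ c)
    (hne : ∀ (u' : U) (b : Bool) (h : I.Hist), u' ≠ u → F ((u', t, b) :: h) = F h)
    (hfail : ∀ h, F h - c ≤ F ((u, t, false) :: h)) (h : I.Hist) :
    F h - (I.n v : ℝ)⁻¹ * ∑ i, (q (some i)).toReal * (if (u, v) ∈ I.E then
      ∑ k, s i (u, ⟨v, k⟩) * (I.p (u, v) * F h + c) else 0) ≤
      ev (I.tsgfRound q s v t h) F := by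
  have hn := I.n_ne_zero v
  rw [ev_tsgfRound]
  have hq := sum_q q
  have e1 : F h = (I.n v : ℝ)⁻¹ * ∑ k : Fin (I.n v), ((q none).toReal * F h +
      ∑ i, (q (some i)).toReal * F h) := by
    rw [← Finset.sum_mul, ← add_mul, hq]
    simp [hn]
  have e2 : ∑ i, (q (some i)).toReal * (if (u, v) ∈ I.E then
      ∑ k, s i (u, ⟨v, k⟩) * (I.p (u, v) * F h + c) else 0) =
      ∑ k, ∑ i, (q (some i)).toReal * (if (u, v) ∈ I.E then
        s i (u, ⟨v, k⟩) * (I.p (u, v) * F h + c) else 0) := by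
    rw [Finset.sum_comm]
    refine Finset.sum_congr rfl fun i _ => ?_
    rw [← Finset.mul_sum]
    split_ifs <;> simp
  rw [e2]
  nth_rewrite 1 [e1]
  rw [← mul_sub, ← Finset.sum_sub_distrib]
  refine mul_le_mul_of_nonneg_left (Finset.sum_le_sum fun k _ => ?_) (by positivity)
  rw [add_sub_assoc, ← Finset.sum_sub_distrib]
  refine add_le_add_right (Finset.sum_le_sum fun i _ => ?_) _
  rw [← mul_sub]
  refine mul_le_mul_of_nonneg_left ?_ ENNReal.toReal_nonneg
  split_ifs with he
  · exact I.le_ev_ppdr_of_local (fun u => (hs i).mem_unit u k) ⟨u, he⟩ hF0 hc hne hfail h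
  · rw [sub_zero]
    -- Here `u` is not adjacent to the arriving type, so `F` cannot change during the round.
    refine le_trans (le_of_eq (ev_const _ _).symm) (ev_mono (I.finite_support_ppdr h)
      fun h' hh => (I.ppdr_induction (P := fun h' => F h' = F h) ?_ rfl hh).ge)
    intro u' b h'' hF
    rw [hne _ _ _ fun hu => he (hu ▸ u'.2), hF]

/-- Offline capacity bounds the charge for successes by `F h / T` and offline patience bounds the
charge for failures by `ΔU u * c / T`. Since the choice probabilities sum to at most one, mixing the
three solutions costs no more than one of them. -/
theorem le_ev_round_of_local (hs : ∀ i, I.LPFeasible (s i)) (hT : 0 < I.T)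
    (u : U) (t : Fin I.T) {F : I.Hist → ℝ} {c : ℝ}
    (hF0 : ∀ h, 0 ≤ F h) (hc : 0 ≤ c)
    (hne : ∀ (u' : U) (b : Bool) (h : I.Hist), u' ≠ u → F ((u', t, b) :: h) = F h)
    (hfail : ∀ h, F h - c ≤ F ((u, t, false) :: h)) (h : I.Hist) :
    F h - (F h + I.ΔU u * c) / I.T ≤ ev I.arr fun v => ev (I.tsgfRound q s v t h) F := by
  have hT' : (0 : ℝ) < I.T := by exact_mod_cast hT
  refine le_trans ?_ (ev_mono (Set.toFinite _) fun v _ =>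
    I.le_ev_tsgfRound_of_local hs u v t hF0 hc hne hfail h)
  rw [ev_sub (Set.toFinite _), ev_const]
  refine sub_le_sub_left ?_ _
  have e1 : ∀ v, (I.arr v).toReal * ((I.n v : ℝ)⁻¹ * ∑ i, (q (some i)).toReal *
      (if (u, v) ∈ I.E then ∑ k, s i (u, ⟨v, k⟩) * (I.p (u, v) * F h + c) else 0)) =
      ∑ i, (q (some i)).toReal / I.T *
      (if (u, v) ∈ I.E then ∑ k, s i (u, ⟨v, k⟩) * (I.p (u, v) * F h + c) else 0) := by
    intro v
    rw [I.arr_eq v hT, Finset.mul_sum, Finset.mul_sum]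
    have := I.n_ne_zero v
    have aux : ∀ a X : ℝ, (I.n v : ℝ) / I.T * ((I.n v : ℝ)⁻¹ * (a * X)) = a / I.T * X := by
      intro a X; field_simp
    exact Finset.sum_congr rfl fun i _ => aux _ _
  rw [ev_fintype, Finset.sum_congr rfl fun v _ => e1 v, Finset.sum_comm]
  have e2 : ∀ i, ∑ v, (q (some i)).toReal / I.T *
      (if (u, v) ∈ I.E then ∑ k, s i (u, ⟨v, k⟩) * (I.p (u, v) * F h + c) else 0) ≤
      (q (some i)).toReal / I.T * (F h + I.ΔU u * c) := by
    intro i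
    rw [← Finset.mul_sum]
    refine mul_le_mul_of_nonneg_left ?_ (div_nonneg ENNReal.toReal_nonneg hT'.le)
    have h1 := mul_le_mul_of_nonneg_right ((hs i).offline_capacity u) (hF0 h)
    have h2 := mul_le_mul_of_nonneg_right ((hs i).offline_patience u) hc
    rw [Finset.sum_mul, sum_copyEdges_offline] at h1 h2
    refine le_trans (le_of_eq ?_) (le_trans (add_le_add h1 h2) (by rw [one_mul]))
    rw [← Finset.sum_add_distrib]
    refine Finset.sum_congr rfl fun v _ => ?_
    split_ifs
    · rw [← Finset.sum_add_distrib]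
      exact Finset.sum_congr rfl fun k _ => by ring
    · simp
  refine (Finset.sum_le_sum fun i _ => e2 i).trans ?_
  rw [← Finset.sum_mul, ← Finset.sum_div, div_mul_eq_mul_div]
  refine div_le_div_of_nonneg_right ?_ hT'.le
  have h1 : ∑ i, (q (some i)).toReal ≤ 1 := by
    linarith [sum_q q, ENNReal.toReal_nonneg (a := q none)]
  refine mul_le_of_le_one_left ?_ h1
  have := hF0 h
  positivity

end round

/-! ### Availability of an offline vertex -/

open Classical in
/-- A lower bound on the probability that `u` is available after `j` further rounds. -/
noncomputable def potential (u : U) (j : ℕ) (h : I.Hist) : ℝ :=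
  if ∃ t, (u, t, true) ∈ h then 0
  else max 0 ((1 - 1 / (I.T : ℝ)) ^ j * (1 - I.fails u h / I.ΔU u) -
    j / I.T * (1 - 1 / (I.T : ℝ)) ^ (j - 1))

theorem potential_nonneg (u : U) (j : ℕ) (h : I.Hist) : 0 ≤ I.potential u j h := by
  unfold potential
  split_ifs
  · exact le_rfl
  · exact le_max_left _ _

open Classical in
-- At `j = 0` the correction term vanishes, and the linear term is nonpositive once the patience of
-- `u` is used up.
theorem potential_zero_le (u : U) (h : I.Hist) :
    I.potential u 0 h ≤ if I.Avail u h then 1 else 0 := by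
  have hΔ : (0 : ℝ) < I.ΔU u := by exact_mod_cast I.ΔU_pos u
  unfold potential
  split_ifs with h1 h2 h2
  · exact zero_le_one
  · exact le_rfl
  · have : (0 : ℝ) ≤ I.fails u h / I.ΔU u := by positivity
    refine max_le zero_le_one ?_
    simpa using this
  · refine max_le le_rfl ?_
    push Not at h1
    have h3 : I.ΔU u ≤ I.fails u h := by
      by_contra h3
      exact h2 ⟨h1, not_le.1 h3⟩
    have : (1 : ℝ) ≤ I.fails u h / I.ΔU u := by
      rw [le_div_iff₀ hΔ, one_mul]
      exact_mod_cast h3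
    simpa using this

theorem potential_cons_of_ne {u u' : U} (hu : u' ≠ u) (j : ℕ) (t : Fin I.T) (b : Bool)
    (h : I.Hist) : I.potential u j ((u', t, b) :: h) = I.potential u j h := by
  have h1 : I.fails u ((u', t, b) :: h) = I.fails u h := by
    unfold fails
    rw [List.countP_cons_of_neg (by simp [hu])]
  simp [potential, h1, Ne.symm hu]

theorem one_sub_inv_mem (hT : 0 < I.T) : 0 ≤ 1 - 1 / (I.T : ℝ) ∧ 1 - 1 / (I.T : ℝ) ≤ 1 := by
  have h1 : (1 : ℝ) ≤ I.T := by exact_mod_cast hT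
  have h2 : 1 / (I.T : ℝ) ≤ 1 := by rw [div_le_one (by linarith)]; exact h1
  have h3 : 0 ≤ 1 / (I.T : ℝ) := by positivity
  constructor <;> linarith

/-- One more failure lowers the linear term by exactly this amount; truncation at zero can only
reduce the loss. -/
theorem potential_cons_fail (hT : 0 < I.T) (u : U) (j : ℕ) (t : Fin I.T) (h : I.Hist) :
    I.potential u j h - (1 - 1 / (I.T : ℝ)) ^ j / I.ΔU u ≤
      I.potential u j ((u, t, false) :: h) := by
  have hq := pow_nonneg (I.one_sub_inv_mem hT).1 j
  have h1 : I.fails u ((u, t, false) :: h) = I.fails u h + 1 := by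
    unfold fails
    rw [List.countP_cons_of_pos (by simp)]
  have h0 : 0 ≤ (1 - 1 / (I.T : ℝ)) ^ j / I.ΔU u := div_nonneg hq (by positivity)
  unfold potential
  simp only [List.mem_cons, Prod.mk.injEq, Bool.true_eq_false, and_false, false_or, h1]
  split_ifs
  · linarith
  · rw [sub_le_iff_le_add]
    refine max_le (add_nonneg (le_max_left _ _) h0) ?_
    rw [← sub_le_iff_le_add]
    refine le_trans (le_of_eq ?_) (le_max_right _ _)
    push_cast
    ring

/-- This explains the formula: as long as `u` is unmatched, the untruncated expression solves `φ
(j+1) = φ j - (φ j + r^j) / T` exactly, where the subtracted term is the worst loss of one round. -/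
theorem potential_succ_le (hT : 0 < I.T) (u : U) (j : ℕ) (h : I.Hist) :
    I.potential u (j + 1) h ≤ max 0 (I.potential u j h -
      (I.potential u j h + (1 - 1 / (I.T : ℝ)) ^ j) / I.T) := by
  by_cases h1 : ∃ t, (u, t, true) ∈ h
  · have : I.potential u (j + 1) h = 0 := by unfold potential; rw [if_pos h1]
    rw [this]
    exact le_max_left _ _
  · have hq := (I.one_sub_inv_mem hT).1
    have hT' : (I.T : ℝ) ≠ 0 := by positivity
    have hle : (1 - 1 / (I.T : ℝ)) ^ j * (1 - I.fails u h / I.ΔU u) -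
        j / I.T * (1 - 1 / (I.T : ℝ)) ^ (j - 1) ≤ I.potential u j h := by
      unfold potential
      rw [if_neg h1]
      exact le_max_right _ _
    have e : I.potential u (j + 1) h = max 0 ((1 - 1 / (I.T : ℝ)) ^ (j + 1) *
        (1 - I.fails u h / I.ΔU u) - (j + 1 : ℕ) / I.T * (1 - 1 / (I.T : ℝ)) ^ j) := by
      unfold potential
      rw [if_neg h1, Nat.add_sub_cancel]
    rw [e]
    refine max_le_max le_rfl ?_
    have h2 := mul_le_mul_of_nonneg_left hle hq
    -- The truncated exponent `j - 1` is harmless at `j = 0` because of the factor `j`.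
    have h3 : (j : ℝ) / I.T * (1 - 1 / (I.T : ℝ)) ^ j =
        (1 - 1 / (I.T : ℝ)) * (j / I.T * (1 - 1 / (I.T : ℝ)) ^ (j - 1)) := by
      cases j with
      | zero => simp
      | succ j => rw [Nat.add_sub_cancel, pow_succ]; ring
    have h4 : I.potential u j h - (I.potential u j h + (1 - 1 / (I.T : ℝ)) ^ j) / I.T =
        (1 - 1 / (I.T : ℝ)) * I.potential u j h - (1 - 1 / (I.T : ℝ)) ^ j / I.T := by
      ring
    rw [h4, pow_succ']
    push_cast
    rw [add_div, add_mul, h3]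
    refine le_trans (le_of_eq ?_) (sub_le_sub_right h2 _)
    ring

/-- Without failures the `j`-th term is at least `r^j - (j/T) r^(j-1) = (j+1) r^j - j r^(j-1)`, so
the sum telescopes to `T r^(T-1)`, and `(1 - 1/T)^(T-1) ≥ 1/e`. -/
theorem sum_potential_nil (hT : 0 < I.T) (u : U) :
    I.T / Real.exp 1 ≤ ∑ j ∈ Finset.range I.T, I.potential u j [] := by
  set q := 1 - 1 / (I.T : ℝ) with hq
  have hT' : (I.T : ℝ) ≠ 0 := by positivity
  have hle : ∀ j, (j + 1 : ℕ) * q ^ j - j * q ^ (j - 1) ≤ I.potential u j [] := by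
    intro j
    have h1 : q ^ j - j / I.T * q ^ (j - 1) ≤ I.potential u j [] := by
      unfold potential
      rw [if_neg (by simp)]
      refine le_trans (le_of_eq ?_) (le_max_right _ _)
      simp [fails, hq]
    refine le_trans (le_of_eq ?_) h1
    cases j with
    | zero => simp
    | succ j =>
      rw [Nat.add_sub_cancel, pow_succ]
      push_cast
      rw [hq]
      field_simp
      ring
  refine le_trans ?_ (Finset.sum_le_sum fun j _ => hle j)
  have htel := Finset.sum_range_sub (fun j : ℕ => (j : ℝ) * q ^ (j - 1)) I.T
  simp only [Nat.add_sub_cancel] at htel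
  rw [htel]
  simp only [Nat.cast_zero, zero_mul, sub_zero, div_eq_mul_inv]
  refine mul_le_mul_of_nonneg_left ?_ (by positivity)
  rw [← Real.exp_neg]
  obtain ⟨m, hm⟩ : ∃ m, I.T = m + 1 := ⟨I.T - 1, by omega⟩
  rw [hm, Nat.add_sub_cancel, hq, hm]
  rcases Nat.eq_zero_or_pos m with rfl | hm0
  · simp
  · have hm' : (0 : ℝ) < m := by exact_mod_cast hm0
    -- With `T = m + 1` the claim becomes `(1 + 1/m)^m ≤ e`.
    have h1 : (1 : ℝ) - 1 / ((m + 1 : ℕ) : ℝ) = (1 + 1 / (m : ℝ))⁻¹ := by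
      push_cast
      field_simp
      ring
    rw [h1, inv_pow, Real.exp_neg]
    refine inv_anti₀ (by positivity) ?_
    have h2 : 1 + 1 / (m : ℝ) ≤ Real.exp (1 / m) := by
      linarith [Real.add_one_le_exp (1 / (m : ℝ))]
    calc (1 + 1 / (m : ℝ)) ^ m ≤ Real.exp (1 / m) ^ m := pow_le_pow_left₀ (by positivity) h2 m
      _ = Real.exp 1 := by
        rw [← Real.exp_nat_mul]
        congr 1
        field_simp

/-! ### All rounds -/

section rounds

variable {q : PMF (Option (Fin 3))} {s : Fin 3 → U × I.Copy → ℝ}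

/-- The cost per failure is `c = r^j / ΔU u`, so that `ΔU u * c = r^j` and the loss of a round
matches the recursion of the potential. -/
theorem potential_succ_le_ev_round (hs : ∀ i, I.LPFeasible (s i)) (hT : 0 < I.T) (u : U)
    (t : Fin I.T) (j : ℕ) (h : I.Hist) : I.potential u (j + 1) h ≤
      ev I.arr fun v => ev (I.tsgfRound q s v t h) (I.potential u j) := by
  refine (I.potential_succ_le hT u j h).trans (max_le ?_ ?_)
  · exact ev_nonneg (Set.toFinite _) fun v _ => ev_nonneg (I.finite_support_tsgfRound _ _ _)
      fun _ _ => I.potential_nonneg u j _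
  · have hΔ : (I.ΔU u : ℝ) ≠ 0 := by
      have := I.ΔU_pos u
      positivity
    have h1 := I.le_ev_round_of_local (q := q) hs hT u t (F := I.potential u j)
      (c := (1 - 1 / (I.T : ℝ)) ^ j / I.ΔU u) (I.potential_nonneg u j)
      (div_nonneg (pow_nonneg (I.one_sub_inv_mem hT).1 j) (by positivity))
      (fun u' b h hu => I.potential_cons_of_ne hu j t b h)
      (fun h => I.potential_cons_fail hT u j t h) h
    rwa [mul_div_cancel₀ _ hΔ] at h1

/-- The law of the history after the rounds of a list, on the arrival sequence `a`. -/
noncomputable def runRounds (q : PMF (Option (Fin 3))) (s : Fin 3 → U × I.Copy → ℝ)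
    (a : Fin I.T → V) : List (Fin I.T) → I.Hist → PMF I.Hist
  | [], h => PMF.pure h
  | t :: ts, h => (I.tsgfRound q s (a t) t h).bind (runRounds q s a ts)

theorem foldl_tsgfRound (a : Fin I.T → V) (ts : List (Fin I.T)) (μ : PMF I.Hist) :
    ts.foldl (fun μ t => μ.bind (I.tsgfRound q s (a t) t)) μ = μ.bind (I.runRounds q s a ts) := by
  induction ts generalizing μ with
  | nil => exact (PMF.bind_pure μ).symm
  | cons t ts ih =>
    rw [List.foldl_cons, ih, PMF.bind_bind]
    rfl

theorem finite_support_runRounds (a : Fin I.T → V) (ts : List (Fin I.T)) (h : I.Hist) :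
    (I.runRounds q s a ts h).support.Finite := by
  induction ts generalizing h with
  | nil => exact finite_support_pure _
  | cons t ts ih =>
    exact finite_support_bind (I.finite_support_tsgfRound _ _ _) fun _ _ => ih _

theorem ev_runRounds_cons (a : Fin I.T → V) (t : Fin I.T) (ts : List (Fin I.T)) (h : I.Hist)
    (F : I.Hist → ℝ) : ev (I.runRounds q s a (t :: ts) h) F =
      ev (I.tsgfRound q s (a t) t h) fun h' => ev (I.runRounds q s a ts h') F :=
  ev_bind (I.finite_support_tsgfRound _ _ _) (fun _ _ => I.finite_support_runRounds _ _ _) F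

theorem runRounds_induction (a : Fin I.T → V) (ts : List (Fin I.T)) {P : I.Hist → Prop}
    (hP : ∀ t ∈ ts, ∀ (u : U) (b : Bool) (h : I.Hist), (u, a t) ∈ I.E → P h → P ((u, t, b) :: h))
    {h h' : I.Hist} (h0 : P h) (hh : h' ∈ (I.runRounds q s a ts h).support) : P h' := by
  induction ts generalizing h with
  | nil =>
    have : h' = h := by simpa [runRounds] using hh
    rwa [this]
  | cons t ts ih =>
    rw [runRounds, PMF.mem_support_bind_iff] at hh
    obtain ⟨h1, hh1, hh⟩ := hh
    exact ih (fun t' ht' => hP t' (List.mem_cons_of_mem _ ht'))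
      (I.tsgfRound_induction (fun u b h hPh => hP t (by simp) u.1 b h u.2 hPh) h0 hh1) hh

/-- Later rounds ignore the current type, which allows it to be redrawn independently of them. -/
theorem runRounds_congr {a a' : Fin I.T → V} (ts : List (Fin I.T)) (haa : ∀ t ∈ ts, a t = a' t)
    (h : I.Hist) : I.runRounds q s a ts h = I.runRounds q s a' ts h := by
  induction ts generalizing h with
  | nil => rfl
  | cons t ts ih =>
    rw [runRounds, runRounds, haa t (by simp)]
    congr 1
    funext h'
    exact ih (fun t' ht' => haa t' (List.mem_cons_of_mem _ ht')) h'

/-- The weight gained by `u` in the rounds of a list. -/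
def gain (w : U × V → ℝ) (u : U) (ts : List (Fin I.T)) (a : Fin I.T → V) (h : I.Hist) : ℝ :=
  (ts.map fun t => if (u, t, true) ∈ h then w (u, a t) else 0).sum

/-- Induction on the remaining rounds: the gain of the current round pays for the term `j = 0`,
which is at most the indicator of availability. Each term `j + 1` is at most the expected term `j`
after the round, which the induction hypothesis pays for. -/
theorem le_ev_gain (hs : ∀ i, I.LPFeasible (s i)) (hT : 0 < I.T) (i : Fin 3) {w : U × V → ℝ}
    (hw : ∀ e, 0 ≤ w e) (u : U) (ts : List (Fin I.T)) (hts : ts.Nodup) (h : I.Hist)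
    (hfresh : ∀ t ∈ ts, ∀ u' b, (u', t, b) ∉ h) :
    (q (some i)).toReal / (2 * I.T) * I.load w (s i) u *
        ∑ j ∈ Finset.range ts.length, I.potential u j h ≤
      ev I.arrivals fun a => ev (I.runRounds q s a ts h) (I.gain w u ts a) := by
  classical
  set B := (q (some i)).toReal / (2 * I.T) * I.load w (s i) u with hB
  have hB0 : 0 ≤ B := by
    refine mul_nonneg (div_nonneg ENNReal.toReal_nonneg (by positivity))
      (Finset.sum_nonneg fun v _ => ?_)
    split_ifs with he
    · exact Finset.sum_nonneg fun k _ => mul_nonneg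
        (mul_nonneg (hw _) ((hs i).mem_unit ⟨u, he⟩ k).1) (I.p_nonneg _ he)
    · exact le_rfl
  induction ts generalizing h with
  | nil => simp [runRounds, gain]
  | cons t ts ih =>
    obtain ⟨ht, hts⟩ := List.nodup_cons.1 hts
    have hfr := hfresh t (by simp)
    set R : V → I.Hist → ℝ := fun v h' => if (u, t, true) ∈ h' then w (u, v) else 0 with hR
    set G : (Fin I.T → V) → I.Hist → ℝ := fun a h' =>
      ev (I.runRounds q s a ts h') (I.gain w u ts a) with hG
    -- Entries never leave a history, so a match made in round `t` still counts at the end.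
    have hstep : ∀ a, (ev (I.tsgfRound q s (a t) t h) fun h' => R (a t) h' + G a h') ≤
        ev (I.runRounds q s a (t :: ts) h) (I.gain w u (t :: ts) a) := by
      intro a
      rw [ev_runRounds_cons]
      refine ev_mono (I.finite_support_tsgfRound _ _ _) fun h' _ => ?_
      have : R (a t) h' + G a h' = ev (I.runRounds q s a ts h') fun h'' =>
          R (a t) h' + I.gain w u ts a h'' := by
        rw [ev_add (I.finite_support_runRounds _ _ _), ev_const]
      rw [this]
      refine ev_mono (I.finite_support_runRounds _ _ _) fun h'' hh => ?_
      simp only [gain, List.map_cons, List.sum_cons, hR]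
      refine add_le_add_left ?_ _
      by_cases hm : (u, t, true) ∈ h'
      · rw [if_pos hm, if_pos]
        exact I.runRounds_induction a ts (P := fun h => (u, t, true) ∈ h)
          (fun _ _ _ _ _ _ hm => List.mem_cons_of_mem _ hm) hm hh
      · rw [if_neg hm]
        split_ifs
        · exact hw _
        · exact le_rfl
    refine le_trans ?_ (ev_mono (Set.toFinite _) fun a _ => hstep a)
    -- The type of round `t` is redrawn, which separates the current round from the arrivals that
    -- the later rounds use.
    have hres : (ev I.arrivals fun a => ev (I.tsgfRound q s (a t) t h) fun h' =>
        R (a t) h' + G a h') = ev I.arr fun v => ev (I.tsgfRound q s v t h) fun h' =>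
          R v h' + ev I.arrivals fun a => G a h' := by
      rw [arrivals, ev_iidLaw_resample I.arr t]
      have hG' : ∀ a v h', G (Function.update a t v) h' = G a h' := by
        intro a v h'
        have hne : ∀ t' ∈ ts, Function.update a t v t' = a t' := fun t' ht' =>
          Function.update_of_ne (by rintro rfl; exact ht ht') _ _
        simp only [hG]
        rw [I.runRounds_congr ts hne]
        congr 1
        funext h''
        unfold gain
        exact congrArg List.sum (List.map_congr_left fun t' ht' => by rw [hne t' ht'])
      simp only [hG', Function.update_self]
      rw [ev_comm (Set.toFinite _) (Set.toFinite _)]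
      refine ev_congr (Set.toFinite _) fun v _ => ?_
      rw [ev_comm (Set.toFinite _) (I.finite_support_tsgfRound _ _ _)]
      refine ev_congr (I.finite_support_tsgfRound _ _ _) fun h' _ => ?_
      rw [ev_add (Set.toFinite _), ev_const]
    rw [hres]
    have hIH : ∀ v, ∀ h' ∈ (I.tsgfRound q s v t h).support,
        B * ∑ j ∈ Finset.range ts.length, I.potential u j h' ≤ ev I.arrivals fun a => G a h' := by
      intro v h' hh
      refine ih hts h' fun t' ht' u' b => ?_
      refine I.tsgfRound_induction (P := fun h => (u', t', b) ∉ h) ?_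
        (hfresh t' (List.mem_cons_of_mem _ ht') u' b) hh
      intro u'' b' h'' hn
      have : t' ≠ t := fun h => ht (h ▸ ht')
      simp [this, hn]
    have hsplit : (ev I.arr fun v => ev (I.tsgfRound q s v t h) fun h' =>
        R v h' + B * ∑ j ∈ Finset.range ts.length, I.potential u j h') =
        (ev I.arr fun v => ev (I.tsgfRound q s v t h) (R v)) +
        B * ∑ j ∈ Finset.range ts.length,
          ev I.arr fun v => ev (I.tsgfRound q s v t h) (I.potential u j) := by
      rw [← ev_sum (Set.toFinite _), ← ev_const_mul, ← ev_add (Set.toFinite _)]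
      refine ev_congr (Set.toFinite _) fun v _ => ?_
      rw [ev_add (I.finite_support_tsgfRound _ _ _), ev_const_mul,
        ev_sum (I.finite_support_tsgfRound _ _ _)]
    refine le_trans ?_ (ev_mono (Set.toFinite _) fun v _ =>
      ev_mono (I.finite_support_tsgfRound _ _ _) fun h' hh => add_le_add_right (hIH v h' hh) _)
    rw [hsplit, List.length_cons, Finset.sum_range_succ', mul_add, add_comm]
    refine add_le_add ?_ (mul_le_mul_of_nonneg_left (Finset.sum_le_sum fun j _ =>
      I.potential_succ_le_ev_round hs hT u t j h) hB0)
    by_cases hav : I.Avail u h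
    · have h1 := I.potential_zero_le u h
      rw [if_pos hav] at h1
      exact (mul_le_of_le_one_right hB0 h1).trans (I.le_ev_round_matched hs hT i hw u t h hav hfr)
    · have h1 := I.potential_zero_le u h
      rw [if_neg hav] at h1
      have h2 : 0 ≤ ev I.arr fun v => ev (I.tsgfRound q s v t h) (R v) :=
        ev_nonneg (Set.toFinite _) fun v _ => ev_nonneg (I.finite_support_tsgfRound _ _ _)
          fun h' _ => by
            simp only [hR]
            split_ifs
            · exact hw _
            · exact le_rfl
      exact (mul_nonpos_of_nonneg_of_nonpos hB0 h1).trans h2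

end rounds

/-! ### The weight of the matching -/

theorem mem_matched (u : U) (t : Fin I.T) (h : I.Hist) :
    (u, t) ∈ I.matched h ↔ (u, t, true) ∈ h := by
  simp [matched]

theorem sum_matched (f : U × Fin I.T → ℝ) (h : I.Hist) :
    ∑ e ∈ I.matched h, f e = ∑ u, ∑ t, if (u, t, true) ∈ h then f (u, t) else 0 := by
  rw [← Fintype.sum_prod_type' (f := fun u t => if (u, t, true) ∈ h then f (u, t) else 0)]
  simp only [← mem_matched, Finset.sum_ite_mem, Finset.univ_inter]

/-- The expected total weight of the matched edges. -/
noncomputable def weight (w : U × V → ℝ) (P : PMF I.Outcome) : ℝ :=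
  expect P fun ω => ∑ e ∈ ω.2, w (e.1, ω.1 e.2)

theorem expect_joint (L : (Fin I.T → V) → PMF I.Matching) (f : I.Outcome → ℝ) :
    expect (I.joint L) f = ev I.arrivals fun a => ev (L a) fun M => f (a, M) := by
  rw [expect_eq_ev, joint, ev_bind (Set.toFinite _) fun _ _ => Set.toFinite _]
  refine ev_congr (Set.toFinite _) fun a _ => ?_
  rw [ev_map (Set.toFinite _)]

theorem expect_joint_eq (L : (Fin I.T → V) → PMF I.Matching) (f : I.Outcome → ℝ) :
    expect (I.joint L) f =
      ev I.arrivals fun a => expect ((L a).map fun M => ((a, M) : I.Outcome)) f := by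
  rw [expect_joint]
  refine ev_congr (Set.toFinite _) fun a _ => ?_
  rw [expect_eq_ev, ev_map (Set.toFinite _)]

/-- The value of a linear program with edge weights `w`. -/
noncomputable def lpWeight (w : U × V → ℝ) (x : U × I.Copy → ℝ) : ℝ :=
  ∑ e ∈ I.copyEdges, w (e.1, e.2.1) * x e * I.p (e.1, e.2.1)

theorem lpWeight_eq_sum_load (w : U × V → ℝ) (x : U × I.Copy → ℝ) :
    I.lpWeight w x = ∑ u, I.load w x u := by
  rw [lpWeight, sum_copyEdges]
  exact Finset.sum_congr rfl fun u _ => I.sum_copyEdges_offline _ u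

/-- Every linear objective of `TSGF` is at least the share `q i / (2 e)` of its value at the
`i`-th solution. -/
theorem le_weight_joint_runRounds [Nonempty V] {q : PMF (Option (Fin 3))}
    {s : Fin 3 → U × I.Copy → ℝ} (hs : ∀ i, I.LPFeasible (s i)) (i : Fin 3) {w : U × V → ℝ}
    (hw : ∀ e ∈ I.E, 0 ≤ w e) {L : (Fin I.T → V) → PMF I.Matching}
    (hL : ∀ a, L a = (I.runRounds q s a (List.finRange I.T) []).map I.matched) :
    (q (some i)).toReal / (2 * Real.exp 1) * I.lpWeight w (s i) ≤ I.weight w (I.joint L) := by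
  classical
  have hT := I.T_pos
  have hT' : (I.T : ℝ) ≠ 0 := by positivity
  -- Weights are nonnegative only on edges. Setting them to zero elsewhere changes neither the loads
  -- nor the weight of a reachable matching.
  set w' : U × V → ℝ := fun e => if e ∈ I.E then w e else 0 with hw'
  have hw0 : ∀ e, 0 ≤ w' e := by
    intro e
    simp only [hw']
    split_ifs with he
    · exact hw e he
    · exact le_rfl
  have hload : ∀ u, I.load w (s i) u = I.load w' (s i) u := by
    intro u
    refine Finset.sum_congr rfl fun v _ => ?_
    split_ifs with he
    · simp [hw', he]
    · rfl
  have hload0 : ∀ u, 0 ≤ I.load w' (s i) u := by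
    intro u
    refine Finset.sum_nonneg fun v _ => ?_
    split_ifs with he
    · exact Finset.sum_nonneg fun k _ => mul_nonneg
        (mul_nonneg (hw0 _) ((hs i).mem_unit ⟨u, he⟩ k).1) (I.p_nonneg _ he)
    · exact le_rfl
  have hval : I.weight w (I.joint L) = ∑ u, ev I.arrivals fun a =>
      ev (I.runRounds q s a (List.finRange I.T) []) (I.gain w' u (List.finRange I.T) a) := by
    rw [weight, expect_joint, ← ev_sum (Set.toFinite _)]
    refine ev_congr (Set.toFinite _) fun a _ => ?_
    rw [hL a, ev_map (I.finite_support_runRounds _ _ _), ← ev_sum (I.finite_support_runRounds _ _ _)]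
    refine ev_congr (I.finite_support_runRounds _ _ _) fun h hh => ?_
    have hE := I.runRounds_induction a (List.finRange I.T)
      (P := fun h => ∀ u t b, (u, t, b) ∈ h → (u, a t) ∈ I.E) (by
        intro t _ u b h he hP u' t' b' hm
        rcases List.mem_cons.1 hm with hm | hm
        · simp only [Prod.mk.injEq] at hm
          obtain ⟨rfl, rfl, rfl⟩ := hm
          exact he
        · exact hP _ _ _ hm) (by simp) hh
    dsimp only
    rw [sum_matched]
    refine Finset.sum_congr rfl fun u _ => ?_
    rw [gain, ← List.ofFn_eq_map, List.sum_ofFn]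
    refine Finset.sum_congr rfl fun t _ => ?_
    split_ifs with hm
    · simp [hw', hE u t true hm]
    · rfl
  rw [hval, lpWeight_eq_sum_load, Finset.mul_sum]
  refine Finset.sum_le_sum fun u _ => ?_
  have h1 := I.le_ev_gain (q := q) hs hT i hw0 u (List.finRange I.T) (List.nodup_finRange _) []
    (by simp)
  refine le_trans ?_ h1
  rw [List.length_finRange, hload]
  have h2 := mul_le_mul_of_nonneg_left (I.sum_potential_nil hT u)
    (mul_nonneg (div_nonneg (ENNReal.toReal_nonneg (a := q (some i)))
      (by positivity : (0 : ℝ) ≤ 2 * I.T)) (hload0 u))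
  refine le_trans (le_of_eq ?_) h2
  field_simp

/-! ### Policies -/

section policy

variable {a : Fin I.T → V} {σ : I.Policy}

open Classical in
theorem runPolicy_succ (k : ℕ) (h : I.Hist) : I.runPolicy a σ (k + 1) h =
    (σ h).bind fun o => o.elim (PMF.pure h) fun e => if I.CanProbe (a e.2) e.2 e.1 h then
      (I.probe (a e.2) e.2 e.1 h).bind (I.runPolicy a σ k) else PMF.pure h := by
  rw [runPolicy]
  congr 1
  funext o
  rcases o with _ | ⟨u, t⟩ <;> rfl

open Classical in
theorem finite_support_runPolicy_step {k : ℕ}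
    (ih : ∀ h, (I.runPolicy a σ k h).support.Finite) (h : I.Hist) (o : Option (U × Fin I.T)) :
    (o.elim (PMF.pure h) fun e => if I.CanProbe (a e.2) e.2 e.1 h then
      (I.probe (a e.2) e.2 e.1 h).bind (I.runPolicy a σ k) else PMF.pure h :
        PMF I.Hist).support.Finite := by
  rcases o with _ | e
  · exact finite_support_pure _
  · simp only [Option.elim]
    split_ifs
    · exact finite_support_bind (I.finite_support_probe _ _ _ _) fun h' _ => ih h'
    · exact finite_support_pure _

theorem finite_support_runPolicy (k : ℕ) (h : I.Hist) : (I.runPolicy a σ k h).support.Finite := by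
  induction k generalizing h with
  | zero => exact finite_support_pure _
  | succ k ih =>
    rw [runPolicy_succ]
    exact finite_support_bind (Set.toFinite _) fun o _ => I.finite_support_runPolicy_step ih h o

theorem runPolicy_induction {P : I.Hist → Prop} (hP : ∀ (u : U) (t : Fin I.T) (b : Bool)
    (h : I.Hist), I.CanProbe (a t) t u h → P h → P ((u, t, b) :: h)) (k : ℕ) {h h' : I.Hist}
    (h0 : P h) (hh : h' ∈ (I.runPolicy a σ k h).support) : P h' := by
  induction k generalizing h with
  | zero =>
    have : h' = h := by simpa [runPolicy] using hh
    rwa [this]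
  | succ k ih =>
    rw [runPolicy_succ, PMF.mem_support_bind_iff] at hh
    obtain ⟨o, -, hh⟩ := hh
    have hpure : h' ∈ (PMF.pure h).support → P h' := by
      intro hh
      have : h' = h := by simpa using hh
      rwa [this]
    rcases o with _ | ⟨u, t⟩
    · exact hpure hh
    · simp only [Option.elim] at hh
      split_ifs at hh with hc
      · rw [PMF.mem_support_bind_iff] at hh
        obtain ⟨h1, hh1, hh⟩ := hh
        obtain ⟨b, rfl⟩ := I.mem_support_probe hh1
        exact ih (hP u t b h hc h0) hh
      · exact hpure hh

/-- A function of the history that every possible probe preserves on average is preserved on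
average by every policy. -/
theorem ev_runPolicy_of_martingale {D : I.Hist → ℝ} (hD : ∀ (u : U) (t : Fin I.T) (h : I.Hist),
    I.CanProbe (a t) t u h → I.p (u, a t) * D ((u, t, true) :: h) +
      (1 - I.p (u, a t)) * D ((u, t, false) :: h) = D h) (k : ℕ) (h : I.Hist) :
    ev (I.runPolicy a σ k h) D = D h := by
  induction k generalizing h with
  | zero => exact ev_pure _ _
  | succ k ih =>
    rw [runPolicy_succ, ev_bind (Set.toFinite _)
      fun o _ => I.finite_support_runPolicy_step (I.finite_support_runPolicy k) h o]
    refine (ev_congr (Set.toFinite _) fun o _ => ?_).trans (ev_const (σ h) (D h))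
    rcases o with _ | ⟨u, t⟩
    · exact ev_pure _ _
    · simp only [Option.elim]
      split_ifs with hc
      · rw [ev_bind (I.finite_support_probe _ _ _ _)
          fun h' _ => I.finite_support_runPolicy k h', funext ih, ev_probe I hc.edge, hD u t h hc]
      · exact ev_pure _ _

open Classical in
/-- The probability that a policy probes the pair `(u, t)`. -/
noncomputable def probeProb (a : Fin I.T → V) (σ : I.Policy) (u : U) (t : Fin I.T) : ℝ :=
  ev (I.runPolicy a σ (Fintype.card U * I.T) []) fun h => if ∃ b, (u, t, b) ∈ h then 1 else 0

/-- The probability that a policy matches the pair `(u, t)`. -/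
noncomputable def matchProb (a : Fin I.T → V) (σ : I.Policy) (u : U) (t : Fin I.T) : ℝ :=
  ev (I.runPolicy a σ (Fintype.card U * I.T) []) fun h => if (u, t, true) ∈ h then 1 else 0

/-- The indicator of a match minus `p` times the indicator of a probe has mean change zero at every
probe: a fresh probe of `(u, t)` raises both terms by `p` on average, any other probe changes
neither. -/
theorem matchProb_eq (u : U) (t : Fin I.T) :
    I.matchProb a σ u t = I.p (u, a t) * I.probeProb a σ u t := by
  classical
  have := I.ev_runPolicy_of_martingale (a := a) (σ := σ) (D := fun h =>
    (if (u, t, true) ∈ h then (1 : ℝ) else 0) -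
      I.p (u, a t) * if ∃ b, (u, t, b) ∈ h then 1 else 0) (by
    intro u' t' h hc
    by_cases he : (u, t) = (u', t')
    · simp only [Prod.mk.injEq] at he
      obtain ⟨rfl, rfl⟩ := he
      have h1 := hc.fresh
      have h2 : ∃ b, b = true ∨ (u, t, b) ∈ h := ⟨true, Or.inl rfl⟩
      have h3 : ∃ b, b = false ∨ (u, t, b) ∈ h := ⟨false, Or.inl rfl⟩
      simp [h1]
      ring
    · simp only [Prod.mk.injEq] at he
      have h1 : ∀ b b', ((u, t, b) ∈ (u', t', b') :: h) ↔ (u, t, b) ∈ h := by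
        intro b b'
        simp only [List.mem_cons, Prod.mk.injEq]
        tauto
      simp only [h1]
      ring) (Fintype.card U * I.T) []
  rw [ev_sub (I.finite_support_runPolicy _ _), ev_const_mul] at this
  simp only [List.not_mem_nil, exists_false, if_false, mul_zero, sub_zero] at this
  exact sub_eq_zero.1 this

theorem probeProb_nonneg (u : U) (t : Fin I.T) : 0 ≤ I.probeProb a σ u t :=
  ev_nonneg (I.finite_support_runPolicy _ _) fun h _ => by split_ifs <;> simp

theorem probeProb_le_one (u : U) (t : Fin I.T) : I.probeProb a σ u t ≤ 1 :=
  ev_le_of_le (I.finite_support_runPolicy _ _) fun h _ => by split_ifs <;> simp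

theorem probeProb_eq_zero {u : U} {t : Fin I.T} (he : (u, a t) ∉ I.E) :
    I.probeProb a σ u t = 0 := by
  refine (ev_congr (I.finite_support_runPolicy _ _) fun h hh => ?_).trans (ev_const _ 0)
  rw [if_neg]
  rintro ⟨b, hb⟩
  refine he (I.runPolicy_induction (P := fun h => ∀ u t b, (u, t, b) ∈ h → (u, a t) ∈ I.E)
    ?_ _ (by simp) hh u t b hb)
  intro u' t' b' h hc hP u t b hm
  rcases List.mem_cons.1 hm with hm | hm
  · simp only [Prod.mk.injEq] at hm
    obtain ⟨rfl, rfl, rfl⟩ := hm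
    exact hc.edge
  · exact hP _ _ _ hm

/-- Disjoint events that are each witnessed by an entry of a list are no more than these
entries. -/
theorem sum_ite_exists_le_countP {ι β : Type*} [Fintype ι] (r : ι → β → Prop) (P : β → Bool)
    (hr : ∀ i j b, r i b → r j b → i = j) (hP : ∀ i b, r i b → P b = true) (h : List β)
    {S : ι → Prop} [DecidablePred S] (hS : ∀ i, S i ↔ ∃ b ∈ h, r i b) :
    (∑ i, if S i then (1 : ℝ) else 0) ≤ h.countP P := by
  classical
  refine (Finset.sum_congr rfl fun i _ => if_congr (hS i) rfl rfl).trans_le ?_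
  clear hS
  induction h with
  | nil => simp
  | cons b h ih =>
    have h1 : ∀ i, (if ∃ b' ∈ b :: h, r i b' then (1 : ℝ) else 0) ≤
        (if r i b then 1 else 0) + if ∃ b ∈ h, r i b then (1 : ℝ) else 0 := by
      intro i
      simp only [List.mem_cons, exists_eq_or_imp]
      by_cases h1 : r i b <;> by_cases h2 : ∃ b ∈ h, r i b <;> simp only [h1, h2] <;> norm_num
    have h2 : (∑ i, if r i b then (1 : ℝ) else 0) ≤ if P b = true then 1 else 0 := by
      by_cases hb : ∃ i, r i b
      · obtain ⟨i, hi⟩ := hb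
        rw [if_pos (hP i b hi), Finset.sum_eq_single i]
        · rw [if_pos hi]
        · intro j _ hj
          rw [if_neg fun h => hj (hr j i b h hi)]
        · simp
      · push Not at hb
        simp only [hb, if_false, Finset.sum_const_zero]
        split_ifs <;> norm_num
    refine (Finset.sum_le_sum fun i _ => h1 i).trans ?_
    rw [Finset.sum_add_distrib, List.countP_cons]
    push_cast
    linarith

/-- The probes whose key `f` is `k` are at most `N`, and at most one of them is successful. -/
def Bounded {κ : Type*} [DecidableEq κ] (f : U × Fin I.T × Bool → κ) (k : κ) (N : ℕ)
    (h : I.Hist) : Prop :=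
  h.countP (fun q => f q = k) ≤ N ∧ h.countP (fun q => f q = k ∧ q.2.2 = true) ≤ 1

/-- If a probe with key `k` is still permitted, all earlier probes with that key failed and there
are fewer than `N` of them. Thus even a final success keeps the total within `N`, so patience bounds
all probes and not only the failures. -/
theorem Bounded.cons {I : KIIDInstance U V 𝒢} {κ : Type*} [DecidableEq κ]
    {f : U × Fin I.T × Bool → κ} {k : κ} {N : ℕ} {h : I.Hist} (hB : I.Bounded f k N h)
    (q : U × Fin I.T × Bool) (h1 : f q = k → ∀ q' ∈ h, f q' = k → q'.2.2 = false)
    (h2 : f q = k → h.countP (fun q => f q = k ∧ q.2.2 = false) < N) :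
    I.Bounded f k N (q :: h) := by
  unfold Bounded at hB ⊢
  by_cases hq : f q = k
  · have e1 : h.countP (fun q => f q = k) = h.countP (fun q => f q = k ∧ q.2.2 = false) := by
      refine List.countP_congr fun q' hq' => ?_
      have := h1 hq q' hq'
      simpa using this
    have e2 : h.countP (fun q => f q = k ∧ q.2.2 = true) = 0 := by
      rw [List.countP_eq_zero]
      intro q' hq'
      have := h1 hq q' hq'
      simp only [decide_eq_true_eq, not_and]
      intro hk
      simp [this hk]
    have h2 := h2 hq
    rw [List.countP_cons, List.countP_cons, e1, e2]
    constructor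
    · split_ifs <;> omega
    · split_ifs <;> omega
  · rw [List.countP_cons_of_neg (by simpa using hq), List.countP_cons_of_neg (by simp [hq])]
    exact hB

theorem bounded_offline (u : U) {h : I.Hist}
    (hh : h ∈ (I.runPolicy a σ (Fintype.card U * I.T) []).support) :
    I.Bounded (fun q => q.1) u (I.ΔU u) h := by
  refine I.runPolicy_induction (P := I.Bounded (fun q => q.1) u (I.ΔU u)) ?_ _ ?_ hh
  · intro u' t b h hc hB
    refine hB.cons _ ?_ ?_
    · rintro rfl ⟨u'', t', b'⟩ hq rfl
      cases b'
      · rfl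
      · exact absurd hq (hc.offline_unmatched t')
    · rintro rfl
      exact hc.offline_patience
  · simp [Bounded]

theorem bounded_online (t : Fin I.T) {h : I.Hist}
    (hh : h ∈ (I.runPolicy a σ (Fintype.card U * I.T) []).support) :
    I.Bounded (fun q => q.2.1) t (I.ΔV (a t)) h := by
  refine I.runPolicy_induction (P := I.Bounded (fun q => q.2.1) t (I.ΔV (a t))) ?_ _ ?_ hh
  · intro u t' b h hc hB
    refine hB.cons _ ?_ ?_
    · rintro rfl ⟨u', t'', b'⟩ hq rfl
      cases b'
      · rfl
      · exact absurd hq (hc.online_unmatched u')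
    · rintro rfl
      exact hc.online_patience
  · simp [Bounded]

/-- The bound holds in every run, hence in expectation. -/
theorem sum_probeProb_offline_le (u : U) : ∑ t, I.probeProb a σ u t ≤ I.ΔU u := by
  classical
  unfold probeProb
  rw [← ev_sum (I.finite_support_runPolicy _ _)]
  refine ev_le_of_le (I.finite_support_runPolicy _ _) fun h hh => ?_
  refine (sum_ite_exists_le_countP
    (fun (t : Fin I.T) (q : U × Fin I.T × Bool) => q.1 = u ∧ q.2.1 = t)
    (fun q => q.1 = u) (fun i j b h1 h2 => h1.2.symm.trans h2.2) (by simp) h ?_).trans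
    (by exact_mod_cast (I.bounded_offline u hh).1)
  simp

theorem sum_probeProb_online_le (t : Fin I.T) : ∑ u, I.probeProb a σ u t ≤ I.ΔV (a t) := by
  classical
  unfold probeProb
  rw [← ev_sum (I.finite_support_runPolicy _ _)]
  refine ev_le_of_le (I.finite_support_runPolicy _ _) fun h hh => ?_
  refine (sum_ite_exists_le_countP
    (fun (u : U) (q : U × Fin I.T × Bool) => q.1 = u ∧ q.2.1 = t)
    (fun q => q.2.1 = t) (fun i j b h1 h2 => h1.1.symm.trans h2.1) (by simp) h ?_).trans
    (by exact_mod_cast (I.bounded_online t hh).1)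
  simp

theorem sum_matchProb_offline_le (u : U) : ∑ t, I.matchProb a σ u t ≤ 1 := by
  classical
  unfold matchProb
  rw [← ev_sum (I.finite_support_runPolicy _ _)]
  refine ev_le_of_le (I.finite_support_runPolicy _ _) fun h hh => ?_
  refine (sum_ite_exists_le_countP
    (fun (t : Fin I.T) (q : U × Fin I.T × Bool) => q = (u, t, true))
    (fun q => q.1 = u ∧ q.2.2 = true) (by rintro i j _ rfl h; simpa using h)
    (by rintro i _ rfl; simp) h ?_).trans (by exact_mod_cast (I.bounded_offline u hh).2)
  simp

theorem sum_matchProb_online_le (t : Fin I.T) : ∑ u, I.matchProb a σ u t ≤ 1 := by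
  classical
  unfold matchProb
  rw [← ev_sum (I.finite_support_runPolicy _ _)]
  refine ev_le_of_le (I.finite_support_runPolicy _ _) fun h hh => ?_
  refine (sum_ite_exists_le_countP
    (fun (u : U) (q : U × Fin I.T × Bool) => q = (u, t, true))
    (fun q => q.2.1 = t ∧ q.2.2 = true) (by rintro i j _ rfl h; simpa using h)
    (by rintro i _ rfl; simp) h ?_).trans (by exact_mod_cast (I.bounded_online t hh).2)
  simp

end policy

/-! ### Policies are bounded by the linear programs -/

theorem ev_arrivals_apply (f : V → ℝ) (t : Fin I.T) :
    (ev I.arrivals fun a => f (a t)) = ev I.arr f := by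
  rw [arrivals, ev_iidLaw_resample I.arr t]
  simp

theorem ev_arrivals_count [Nonempty V] (v : V) :
    (ev I.arrivals fun a => ∑ t, if a t = v then (1 : ℝ) else 0) = I.n v := by
  rw [ev_sum (Set.toFinite _)]
  simp only [I.ev_arrivals_apply fun v' => if v' = v then (1 : ℝ) else 0]
  simp [ev_fintype, I.n_eq v]

theorem sum_nbr {v : V} {G : U → ℝ} (hG : ∀ u, (u, v) ∉ I.E → G u = 0) :
    ∑ u : I.Nbr v, G u.1 = ∑ u, G u := by
  rw [← Finset.sum_subtype (Finset.univ.filter fun u => (u, v) ∈ I.E) (by simp) G,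
    Finset.sum_filter]
  refine Finset.sum_congr rfl fun u _ => ?_
  split_ifs with h
  · rfl
  · exact (hG u h).symm

section benchmark

variable (σ : (Fin I.T → V) → I.Policy)

/-- The expected number of probes between `u` and vertices of type `v`. -/
noncomputable def probeCount (u : U) (v : V) : ℝ :=
  ev I.arrivals fun a => ∑ t, if a t = v then I.probeProb a (σ a) u t else 0

/-- The solution of the linear programs that belongs to a policy. -/
noncomputable def policySolution (e : U × I.Copy) : ℝ := I.probeCount σ e.1 e.2.1 / I.n e.2.1

theorem probeCount_eq_zero {u : U} {v : V} (he : (u, v) ∉ I.E) : I.probeCount σ u v = 0 := by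
  refine (ev_congr (Set.toFinite _) fun a _ => Finset.sum_eq_zero fun t _ => ?_).trans
    (ev_const _ 0)
  split_ifs with h
  · subst h
    exact I.probeProb_eq_zero he
  · rfl

theorem sum_mul_probeCount (c : V → ℝ) (u : U) : ∑ v, c v * I.probeCount σ u v =
    ev I.arrivals fun a => ∑ t, c (a t) * I.probeProb a (σ a) u t := by
  simp only [probeCount, ← ev_const_mul]
  rw [← ev_sum (Set.toFinite _)]
  refine ev_congr (Set.toFinite _) fun a _ => ?_
  simp only [Finset.mul_sum]
  rw [Finset.sum_comm]
  refine Finset.sum_congr rfl fun t _ => ?_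
  simp

/-- The `n v` equal shares of `probeCount` add up again, so LP sums at `u` become expected sums over
the rounds. -/
theorem sum_copyEdges_policySolution (c : V → ℝ) (u : U) :
    (∑ v, if (u, v) ∈ I.E then ∑ k, c v * I.policySolution σ (u, ⟨v, k⟩) else 0) =
      ev I.arrivals fun a => ∑ t, c (a t) * I.probeProb a (σ a) u t := by
  rw [← sum_mul_probeCount]
  refine Finset.sum_congr rfl fun v _ => ?_
  have := I.n_ne_zero v
  split_ifs with he
  · simp only [policySolution, Finset.sum_const, Finset.card_univ, Fintype.card_fin, nsmul_eq_mul]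
    field_simp
  · rw [I.probeCount_eq_zero σ he, mul_zero]

/-- Every arrival of the type obeys the bound `N` and there are `n` of them on average; dividing by
`n` gives the bound for one copy. -/
theorem sum_nbr_policySolution_le [Nonempty V] (c : I.Copy) (d : U → ℝ) (N : ℝ)
    (hN : ∀ a t, a t = c.1 → ∑ u, I.probeProb a (σ a) u t * d u ≤ N) :
    ∑ u : I.Nbr c.1, I.policySolution σ (u.1, c) * d u.1 ≤ N := by
  have hn := I.n_ne_zero c.1
  have hn0 : (0 : ℝ) < I.n c.1 := by exact_mod_cast I.n_pos c.1
  rw [I.sum_nbr (G := fun u => I.policySolution σ (u, c) * d u) fun u he => by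
    simp [policySolution, I.probeCount_eq_zero σ he]]
  have e1 : ∑ u, I.policySolution σ (u, c) * d u =
      (ev I.arrivals fun a => ∑ t, if a t = c.1 then
        ∑ u, I.probeProb a (σ a) u t * d u else 0) / I.n c.1 := by
    simp only [policySolution, div_mul_eq_mul_div, ← Finset.sum_div, probeCount, ← ev_mul_const]
    rw [← ev_sum (Set.toFinite _)]
    congr 1
    refine ev_congr (Set.toFinite _) fun a _ => ?_
    simp only [Finset.sum_mul]
    rw [Finset.sum_comm]
    refine Finset.sum_congr rfl fun t _ => ?_
    split_ifs <;> simp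
  rw [e1, div_le_iff₀ hn0, ← I.ev_arrivals_count c.1, ← ev_const_mul]
  refine ev_mono (Set.toFinite _) fun a _ => ?_
  rw [Finset.mul_sum]
  refine Finset.sum_le_sum fun t _ => ?_
  split_ifs with h
  · rw [mul_one]; exact hN a t h
  · simp

/-- Offline constraints hold for each arrival sequence and are averaged. Online constraints hold for
each arrival, and averaging over the arrivals of a type transfers them to its copies. -/
theorem policySolution_feasible [Nonempty V] : I.LPFeasible (I.policySolution σ) where
  nonneg e _ := div_nonneg (ev_nonneg (Set.toFinite _) fun a _ => Finset.sum_nonneg fun t _ => by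
    split_ifs
    · exact I.probeProb_nonneg _ _
    · exact le_rfl) (Nat.cast_nonneg _)
  le_one e _ := by
    have hn0 : (0 : ℝ) < I.n e.2.1 := by exact_mod_cast I.n_pos e.2.1
    rw [policySolution, div_le_one hn0, ← I.ev_arrivals_count e.2.1]
    refine ev_mono (Set.toFinite _) fun a _ => Finset.sum_le_sum fun t _ => ?_
    split_ifs
    · exact I.probeProb_le_one _ _
    · exact le_rfl
  offline_capacity u := by
    have h1 := I.sum_copyEdges_policySolution σ (fun v => I.p (u, v)) u
    simp only [sum_copyEdges_offline, mul_comm (I.policySolution σ _)]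
    rw [h1]
    refine ev_le_of_le (Set.toFinite _) fun a _ => ?_
    simp only [← matchProb_eq]
    exact I.sum_matchProb_offline_le u
  offline_patience u := by
    have h1 := I.sum_copyEdges_policySolution σ (fun _ => 1) u
    simp only [one_mul] at h1
    rw [sum_copyEdges_offline, h1]
    exact ev_le_of_le (Set.toFinite _) fun a _ => I.sum_probeProb_offline_le u
  online_capacity c := by
    rw [sum_copyEdges_online]
    refine I.sum_nbr_policySolution_le σ c (fun u => I.p (u, c.1)) 1 fun a t h => ?_
    simp only [← h, mul_comm (I.probeProb a (σ a) _ t), ← matchProb_eq]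
    exact I.sum_matchProb_online_le t
  online_patience c := by
    rw [sum_copyEdges_online]
    have h1 := I.sum_nbr_policySolution_le σ c (fun _ => 1) (I.ΔV c.1) fun a t h => by
      simp only [← h, mul_one]
      exact I.sum_probeProb_online_le t
    simpa only [mul_one] using h1

/-- The solution does not depend on `w`, so one LP point reproduces the values of all groups
simultaneously, as the minima require. -/
theorem weight_joint_policyLaw (w : U × V → ℝ) :
    I.weight w (I.joint fun a => I.policyLaw a (σ a)) = I.lpWeight w (I.policySolution σ) := by
  rw [lpWeight_eq_sum_load]
  have e1 : ∀ u, I.load w (I.policySolution σ) u = ev I.arrivals fun a =>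
      ∑ t, w (u, a t) * I.matchProb a (σ a) u t := by
    intro u
    have h1 := I.sum_copyEdges_policySolution σ (fun v => w (u, v) * I.p (u, v)) u
    simp only [matchProb_eq, ← mul_assoc]
    rw [← h1, load]
    refine Finset.sum_congr rfl fun v _ => if_congr Iff.rfl (Finset.sum_congr rfl fun k _ => ?_) rfl
    ring
  simp only [e1]
  rw [← ev_sum (Set.toFinite _), weight, expect_joint]
  refine ev_congr (Set.toFinite _) fun a _ => ?_
  rw [policyLaw, ev_map (I.finite_support_runPolicy _ _)]
  simp only [sum_matched]
  rw [ev_sum (I.finite_support_runPolicy _ _)]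
  refine Finset.sum_congr rfl fun u _ => ?_
  rw [ev_sum (I.finite_support_runPolicy _ _)]
  refine Finset.sum_congr rfl fun t _ => ?_
  rw [matchProb, ← ev_const_mul]
  simp

end benchmark

/-! ### Competitiveness -/

/-- For an objective that does not decrease when it is evaluated on a mixture of outcomes, the
comparison with every policy that knows the arrivals implies the comparison with the expected
optimum. -/
theorem isCompetitive_of_policies {obj : PMF I.Outcome → ℝ} {c : ℝ} (hc : 0 < c)
    {L : (Fin I.T → V) → PMF I.Matching}
    (hobj : ∀ L : (Fin I.T → V) → PMF I.Matching,
      (ev I.arrivals fun a => obj ((L a).map fun M => (a, M))) ≤ obj (I.joint L))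
    (h : ∀ σ : (Fin I.T → V) → I.Policy,
      c * obj (I.joint fun a => I.policyLaw a (σ a)) ≤ obj (I.joint L)) :
    I.IsCompetitive obj c L := by
  refine ⟨le_of_forall_pos_le_add fun ε hε => ?_, h⟩
  have hε' : 0 < ε / c := div_pos hε hc
  have hne : Nonempty I.Policy := ⟨fun _ => PMF.pure none⟩
  -- The supremum need not be attained; slack `ε / c` becomes `ε` after multiplication by `c`.
  have hσ : ∀ a, ∃ σ : I.Policy,
      I.optAt obj a - ε / c < obj ((I.policyLaw a σ).map fun M => (a, M)) := fun a =>
    exists_lt_of_lt_ciSup (sub_lt_self _ hε')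
  choose σ hσ using hσ
  have h1 : I.opt obj - ε / c ≤ ev I.arrivals fun a =>
      obj ((I.policyLaw a (σ a)).map fun M => (a, M)) := by
    rw [opt, expect_eq_ev, ← ev_const I.arrivals (ε / c), ← ev_sub (Set.toFinite _)]
    exact ev_mono (Set.toFinite _) fun a _ => (hσ a).le
  have h2 := mul_le_mul_of_nonneg_left (h1.trans (hobj fun a => I.policyLaw a (σ a))) hc.le
  have h3 := h2.trans (h σ)
  rw [mul_sub, mul_div_cancel₀ _ hc.ne'] at h3
  linarith

/-- The objective that a group of offline vertices contributes, as edge weights. -/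
def offlineWeight (g : 𝒢) (e : U × V) : ℝ := if I.gU e.1 = g then I.wU e else 0

/-- The objective that a group of online types contributes, as edge weights. -/
def onlineWeight (g : 𝒢) (e : U × V) : ℝ := if I.gV e.2 = g then I.wV e else 0

theorem offlineGroup_eq (P : PMF I.Outcome) (g : 𝒢) : I.offlineGroup P g =
    I.weight (I.offlineWeight g) P / (Finset.univ.filter fun u => I.gU u = g).card := by
  unfold offlineGroup weight offlineWeight
  congr 2
  funext ω
  rw [Finset.sum_fiberwise_eq_sum_filter, Finset.sum_filter]
  simp

theorem onlineGroup_eq (P : PMF I.Outcome) (g : 𝒢) : I.onlineGroup P g =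
    I.weight (I.onlineWeight g) P / ∑ v with I.gV v = g, (I.n v : ℝ) := by
  unfold onlineGroup weight onlineWeight
  congr 2
  funext ω
  rw [Finset.sum_fiberwise_eq_sum_filter, Finset.sum_filter]
  simp

theorem lpOffline_eq [Nonempty U] (x : U × I.Copy → ℝ) : I.lpOffline x =
    (Finset.univ.image I.gU).inf' (Finset.univ_nonempty.image _) fun g =>
      I.lpWeight (I.offlineWeight g) x / (Finset.univ.filter fun u => I.gU u = g).card := by
  unfold lpOffline lpWeight offlineWeight
  congr 1
  funext g
  congr 1
  rw [Finset.sum_fiberwise_eq_sum_filter, Finset.sum_filter]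
  simp

theorem lpOnline_eq [Nonempty V] (x : U × I.Copy → ℝ) : I.lpOnline x =
    (Finset.univ.image I.gV).inf' (Finset.univ_nonempty.image _) fun g =>
      I.lpWeight (I.onlineWeight g) x / ∑ v with I.gV v = g, (I.n v : ℝ) := by
  unfold lpOnline lpWeight onlineWeight
  congr 1
  funext g
  congr 1
  · rw [Finset.sum_fiberwise_eq_sum_filter, Finset.sum_filter]
    simp
  -- The number of copies in a group is the sum of `n v` over its types, so LP and objective share
  -- the denominator.
  · rw [Finset.card_filter, Fintype.sum_sigma, Finset.sum_filter]
    push_cast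
    refine Finset.sum_congr rfl fun v _ => ?_
    split_ifs <;> simp

theorem ev_weight_map (w : U × V → ℝ) (L : (Fin I.T → V) → PMF I.Matching) :
    (ev I.arrivals fun a => I.weight w ((L a).map fun M => (a, M))) = I.weight w (I.joint L) :=
  (I.expect_joint_eq L _).symm

/-- The competitive ratio for an objective that is the minimum of scaled linear objectives. -/
theorem isCompetitive_inf' [Nonempty V] {G : Finset 𝒢} (hG : G.Nonempty)
    (w : 𝒢 → U × V → ℝ) (d : 𝒢 → ℝ) (hd : ∀ g, 0 ≤ d g) {obj : PMF I.Outcome → ℝ}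
    {lpObj : (U × I.Copy → ℝ) → ℝ}
    (hobj : ∀ P, obj P = G.inf' hG fun g => I.weight (w g) P / d g)
    (hlp : ∀ x, lpObj x = G.inf' hG fun g => I.lpWeight (w g) x / d g)
    {c : ℝ} (hc : 0 < c) {L : (Fin I.T → V) → PMF I.Matching} {x : U × I.Copy → ℝ}
    (hx : I.IsOptimalLP lpObj x)
    (hL : ∀ g, c * I.lpWeight (w g) x ≤ I.weight (w g) (I.joint L)) :
    I.IsCompetitive obj c L := by
  refine I.isCompetitive_of_policies hc (fun L => ?_) fun σ => ?_
  · rw [hobj]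
    -- Concavity of the minimum: the average of minima is at most each averaged linear functional.
    refine Finset.le_inf' _ _ fun g hg => ?_
    rw [← ev_weight_map, div_eq_mul_inv, ← ev_mul_const]
    refine ev_mono (Set.toFinite _) fun a _ => ?_
    rw [hobj, ← div_eq_mul_inv]
    exact Finset.inf'_le _ hg
  · have h1 := hx.2 _ (I.policySolution_feasible σ)
    have h2 : obj (I.joint fun a => I.policyLaw a (σ a)) = lpObj (I.policySolution σ) := by
      rw [hobj, hlp]
      simp only [weight_joint_policyLaw]
    rw [h2]
    refine (mul_le_mul_of_nonneg_left h1 hc.le).trans ?_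
    rw [hobj, hlp]
    refine Finset.le_inf' _ _ fun g hg => ?_
    refine (mul_le_mul_of_nonneg_left (Finset.inf'_le _ hg) hc.le).trans ?_
    rw [← mul_div_assoc]
    exact div_le_div_of_nonneg_right (hL g) (hd g)

/-- All three solutions must be feasible whichever `i` is considered, because the other two also
consume offline vertices. -/
theorem le_weight_joint_tsgf [Nonempty V] {α β γ : ℝ} (hα : 0 < α) (hβ : 0 < β) (hγ : 0 < γ)
    (hs : α + β + γ ≤ 1) {x y z : U × I.Copy → ℝ} (hx : I.LPFeasible x) (hy : I.LPFeasible y)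
    (hz : I.LPFeasible z) (i : Fin 3) {w : U × V → ℝ} (hw : ∀ e ∈ I.E, 0 ≤ w e) :
    ![α, β, γ] i / (2 * Real.exp 1) * I.lpWeight w (![x, y, z] i) ≤
      I.weight w (I.joint (I.tsgf α β γ hα hβ hγ hs x y z)) := by
  have hf : ∀ i, I.LPFeasible (![x, y, z] i) := by
    intro i
    fin_cases i
    · exact hx
    · exact hy
    · exact hz
  have hq : (choice α β γ hα hβ hγ hs (some i)).toReal = ![α, β, γ] i := by
    have h0 : 0 ≤ ![α, β, γ] i := by
      fin_cases i
      · exact hα.le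
      · exact hβ.le
      · exact hγ.le
    exact ENNReal.toReal_ofReal h0
  rw [← hq]
  refine I.le_weight_joint_runRounds hf i hw fun a => ?_
  rw [tsgf, foldl_tsgfRound, PMF.pure_bind]

end KIIDInstance
end OnlineMatching

/-! ### The three competitive ratios -/

theorem mainTheorem1 {U V 𝒢 : Type*} [Fintype U] [DecidableEq U] [Nonempty U]
    [Fintype V] [DecidableEq V] [Nonempty V] [DecidableEq 𝒢]
    (I : OnlineMatching.KIIDInstance U V 𝒢)
    (α β γ : ℝ) (hα : 0 < α) (hβ : 0 < β) (hγ : 0 < γ) (hs : α + β + γ ≤ 1)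
    (x y z : U × I.Copy → ℝ)
    (hx : I.IsOptimalLP I.lpProfit x)
    (hy : I.IsOptimalLP I.lpOffline y)
    (hz : I.IsOptimalLP I.lpOnline z) :
    I.IsCompetitive I.profit (α / (2 * Real.exp 1)) (I.tsgf α β γ hα hβ hγ hs x y z) ∧
    I.IsCompetitive I.offlineFairness (β / (2 * Real.exp 1)) (I.tsgf α β γ hα hβ hγ hs x y z) ∧
    I.IsCompetitive I.onlineFairness (γ / (2 * Real.exp 1)) (I.tsgf α β γ hα hβ hγ hs x y z) := by
  refine ⟨?_, ?_, ?_⟩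
  -- The profit is a minimum over a single, arbitrarily named group with denominator 1.
  · refine I.isCompetitive_inf' (Finset.singleton_nonempty (I.gV (Classical.arbitrary V)))
      (fun _ => I.wO) (fun _ => 1)
      (fun _ => zero_le_one) (fun P => ?_) (fun x => ?_) (by positivity) hx
      fun _ => I.le_weight_joint_tsgf hα hβ hγ hs hx.1 hy.1 hz.1 0 I.wO_nonneg
    · rw [Finset.inf'_singleton, div_one]
      rfl
    · rw [Finset.inf'_singleton, div_one]
      rfl
  · refine I.isCompetitive_inf' (Finset.univ_nonempty.image I.gU) I.offlineWeight _
      (fun _ => Nat.cast_nonneg _) (fun P => ?_) I.lpOffline_eq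
      (by positivity) hy fun g => I.le_weight_joint_tsgf hα hβ hγ hs hx.1 hy.1 hz.1 1 fun e he => ?_
    · simp only [OnlineMatching.KIIDInstance.offlineFairness, ← I.offlineGroup_eq]
    · unfold OnlineMatching.KIIDInstance.offlineWeight
      split_ifs
      · exact I.wU_nonneg e he
      · exact le_rfl
  · refine I.isCompetitive_inf' (Finset.univ_nonempty.image I.gV) I.onlineWeight _
      (fun _ => Finset.sum_nonneg fun _ _ => Nat.cast_nonneg _) (fun P => ?_) I.lpOnline_eq
      (by positivity) hz fun g => I.le_weight_joint_tsgf hα hβ hγ hs hx.1 hy.1 hz.1 2 fun e he => ?_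
    · simp only [OnlineMatching.KIIDInstance.onlineFairness, ← I.onlineGroup_eq]
    · unfold OnlineMatching.KIIDInstance.onlineWeight
      split_ifs
      · exact I.wV_nonneg e he
      · exact le_rfl
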